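/- Let $\mathbf{k}$ be a nonzero commutative unitary ring and let $c,\lambda\in\mathbf{k}$. For a set $Z$ let $\mathfrak{M}(Z)$ be the free operated monoid on $Z$ (the set of bracketed words, with bracket operator $u\mapsto\lfloor u\rfloor$) and let $\mathbf{k}\langle\!\langle Z\rangle\!\rangle=\mathbf{k}\mathfrak{M}(Z)$ be the free operated unitary associative algebra on $Z$. Let $B(x,y)\in\mathbf{k}\langle\!\langle x,y\rangle\!\rangle$ be any of the following 14 expressions: (a) $x\lfloor y\rfloor$ (average operator); (b) $\lfloor x\rfloor y$ (inverse average operator); (c) $x\lfloor y\rfloor+y\lfloor x\rfloor$; (d) $\lfloor x\rfloor y+\lfloor y\rfloor x$; (e) $x\lfloor y\rfloor+\lfloor x\rfloor y-\lfloor xy\rfloor$ (Nijenhuis operator); (f) $x\lfloor y\rfloor+\lfloor x\rfloor y+\lambda xy$ (Rota-Baxter operator of weight $\lambda$); (g) $x\lfloor y\rfloor-x\lfloor 1\rfloor y+\lambda xy$; (h) $\lfloor x\rfloor y-x\lfloor 1\rfloor y+\lambda xy$; (i) $x\lfloor y\rfloor+\lfloor x\rfloor y-x\lfloor 1\rfloor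 y+\lambda xy$ (generalized TD operator); (j) $x\lfloor y\rfloor+\lfloor x\rfloor y-xy\lfloor 1\rfloor-x\lfloor 1\rfloor y+\lambda xy$; (k) $x\lfloor y\rfloor+\lfloor x\rfloor y-x\lfloor 1\rfloor y-\lfloor xy\rfloor+\lambda xy$; (l) $x\lfloor y\rfloor+\lfloor x\rfloor y-x\lfloor 1\rfloor y-\lfloor 1\rfloor xy+\lambda xy$; (m) $c\,x\lfloor 1\rfloor y+\lambda xy$ (generalized endomorphisms); (n) $c\,y\lfloor 1\rfloor x+\lambda yx$ (generalized antimorphisms). Put $\phi=\lfloor x\rfloor\lfloor y\rfloor-\lfloor B(x,y)\rfloor$. A $\star$-bracketed word $q$ is a bracketed word on $Z\sqcup\{\star\}$ in which $\star$ occurs exactly once, and $q|_f$ denotes the (linear) substitution of $f$ for $\star$. Let $\Pi_\phi(Z)$ be the rewriting system on $\mathbf{k}\mathfrak{M}(Z)$ with the rules $q|_{\lfloor u\rfloor\lfloor v\rfloor}\to q|_{\lfloor B(u,v)\rfloor}$, for $u,v\in\mathfrak{M}(Z)$ and $\star$-bracketed words $q$, a rule being applied to one monomial of an element at a time. Let $S_\phi(Z)=\{\phi(u,v):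 u,v\in\mathfrak{M}(Z)\}$. (1) $\phi$ is of Rota-Baxter type. That is: in every monomial of $B$ each of $x,y$ occurs exactly once; no monomial of $B$ has a subword $\lfloor u\rfloor\lfloor v\rfloor$; for every set $Z$ the system $\Pi_\phi(Z)$ is terminating; and for every set $Z$ and all $u,v,w\in\mathfrak{M}(Z)$ the element $B(B(u,v),w)-B(u,B(v,w))$ reduces to $0$ under $\Pi_\phi(Z)$. Let $Z$ now be any well-ordered set. Write each word as $u=u_0\lfloor\tilde u_1\rfloor u_1\cdots\lfloor\tilde u_r\rfloor u_r$ with $u_i$ in the free monoid $M(Z)$ and $\tilde u_i\in\mathfrak{M}(Z)$. Let $\le_{db}$ be the order on $\mathfrak{M}(Z)$ that compares first the total number of brackets, then $r$, and then, lexicographically, the tuples $(\tilde u_1,\dots,\tilde u_r,u_0,\dots,u_r)$, where the $\tilde u_i$ are compared recursively by $\le_{db}$ and the $u_i$ by the degree lexicographical order. A monomial order on $\mathfrak{M}(Z)$ is a well order such that $u<v$ implies $q|_u<q|_v$ for all $q$; it is compatible with $\Pi_\phi(Z)$ if all monomials of $\lfloor B(u,v)\rfloor$ are smaller than $\lfloor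 u\rfloor\lfloor v\rfloor$, for all $u,v\in\mathfrak{M}(Z)$. (2) The order $\le_{db}$ is a monomial order compatible with $\Pi_\phi(Z)$; the system $\Pi_\phi(Z)$ is convergent (terminating and confluent); and $S_\phi(Z)$ is a Gröbner-Shirshov basis in $\mathbf{k}\langle\!\langle Z\rangle\!\rangle$ with respect to $\le_{db}$, and with respect to every monomial order compatible with $\Pi_\phi(Z)$. Here a set $S$ is a Gröbner-Shirshov basis if its elements are monic and, for all $f,g\in S$ with leading monomials $\bar f,\bar g$, every intersection composition $f\mu-\nu g$ with $w=\bar f\mu=\nu\bar g$ and $\max\{|\bar f|,|\bar g|\}<|w|<|\bar f|+|\bar g|$ (where $|\cdot|$ is the number of factors from $Z\sqcup\lfloor\mathfrak{M}(Z)\rfloor$) and every including composition $f-q|_g$ with $w=\bar f=q|_{\bar g}$ is a linear combination of elements $p|_s$ with $s\in S$, $p$ a $\star$-bracketed word and $p|_{\bar s}<w$. (3) Let $\mathfrak{R}(Z)$ be the set of words in $\mathfrak{M}(Z)$ without a subword $\lfloor u\rfloor\lfloor v\rfloor$, let $I_\phi(Z)$ be the operated ideal of $\mathbf{k}\langle\!\langle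 Z\rangle\!\rangle$ generated by all $\phi(f,g)$ with $f,g\in\mathbf{k}\langle\!\langle Z\rangle\!\rangle$, and let $\eta:\mathbf{k}\langle\!\langle Z\rangle\!\rangle\to\mathbf{k}\langle\!\langle Z\rangle\!\rangle/I_\phi(Z)$ be the quotient map. The composition of the inclusion $\mathbf{k}\mathfrak{R}(Z)\hookrightarrow\mathbf{k}\langle\!\langle Z\rangle\!\rangle$ with $\eta$ is an isomorphism of $\mathbf{k}$-modules, and $\eta(\mathfrak{R}(Z))$ is a $\mathbf{k}$-basis of the quotient. Let $\alpha$ be the inverse isomorphism and $\mathrm{Red}=\alpha\circ\eta$. Define a bilinear multiplication $\diamond$ on $\mathbf{k}\mathfrak{R}(Z)$ as follows: for $u,v\in\mathfrak{R}(Z)$, if $u=a\lfloor s\rfloor$ ends with a bracket and $v=\lfloor t\rfloor b$ begins with a bracket, then $u\diamond v=a\lfloor\mathrm{Red}(B(s,t))\rfloor b$, and otherwise $u\diamond v=uv$ is the concatenation. Then $\mathbf{k}\mathfrak{R}(Z)$ with the multiplication $\diamond$, the empty word as unit, and the linear extension of the operator $\lfloor\ \rfloor$ is the free $\phi$-algebra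 on $Z$: it is a unitary associative operated algebra in which $\phi$ vanishes identically, and every map from $Z$ to an operated algebra $R$ in which $\phi$ vanishes identically extends uniquely to a morphism of operated algebras $\mathbf{k}\mathfrak{R}(Z)\to R$. -/

import Mathlib

universe u v w

namespace RotaBaxterType

/-! ### Bracketed words -/

/-- Bracketed words on `Z`: the free operated monoid `𝔐(Z) = M(Z ⊔ ⌊𝔐(Z)⌋)`.
A word is the empty word `1`, a word `z w` beginning with a letter `z ∈ Z`, or a word `⌊u⌋ w`
beginning with a bracket. -/
inductive BW (Z : Type u) : Type u
  | one : BW Z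
  | consVar (z : Z) (w : BW Z) : BW Z
  | consBr (u w : BW Z) : BW Z

namespace BW

variable {Z : Type u}

/-- Concatenation of bracketed words. -/
def append : BW Z → BW Z → BW Z
  | one, v => v
  | consVar z w, v => consVar z (append w v)
  | consBr u w, v => consBr u (append w v)

theorem append_one (a : BW Z) : append a one = a := by
  induction a with
  | one => rfl
  | consVar z w ih => simp [append, ih]
  | consBr u w _ ih => simp [append, ih]

theorem append_assoc (a b c : BW Z) : append (append a b) c = append a (append b c) := by
  induction a with
  | one => rfl
  | consVar z w ih => simp [append, ih]
  | consBr u w _ ih => simp [append, ih]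

instance : Monoid (BW Z) where
  mul := append
  one := one
  mul_assoc := append_assoc
  one_mul _ := rfl
  mul_one := append_one

/-- The word consisting of the single letter `z`. -/
def var (z : Z) : BW Z := consVar z one

/-- The bracket operator `u ↦ ⌊u⌋`. -/
def br (u : BW Z) : BW Z := consBr u one

/-- The breadth: the number of factors from `Z ⊔ ⌊𝔐(Z)⌋`. -/
def breadth : BW Z → ℕ
  | one => 0
  | consVar _ w => breadth w + 1
  | consBr _ w => breadth w + 1

/-- The `P`-degree: the total number of brackets. -/
def degP : BW Z → ℕ
  | one => 0
  | consVar _ w => degP w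
  | consBr u w => degP u + 1 + degP w

/-- For `u = u₀ ⌊ũ₁⌋ u₁ ⋯ ⌊ũᵣ⌋ uᵣ` with `uᵢ ∈ M(Z)`, the list `ũ₁, …, ũᵣ`. -/
def brackets : BW Z → List (BW Z)
  | one => []
  | consVar _ w => brackets w
  | consBr u w => u :: brackets w

/-- For `u = u₀ ⌊ũ₁⌋ u₁ ⋯ ⌊ũᵣ⌋ uᵣ` with `uᵢ ∈ M(Z)`, the list `u₀, …, uᵣ`. -/
def segments : BW Z → List (List Z)
  | one => [[]]
  | consVar z w =>
    match segments w with
    | [] => [[z]]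
    | s :: t => (z :: s) :: t
  | consBr _ w => [] :: segments w

/-- The `P`-breadth `r` of `u = u₀ ⌊ũ₁⌋ u₁ ⋯ ⌊ũᵣ⌋ uᵣ`. -/
def breadthP (u : BW Z) : ℕ := u.brackets.length

open Classical in
/-- The number of occurrences of the letter `z`, at any depth. -/
noncomputable def count (z : Z) : BW Z → ℕ
  | one => 0
  | consVar y w => (if y = z then 1 else 0) + count z w
  | consBr u w => count z u + count z w

end BW

/-- `⋆`-bracketed words on `Z`: bracketed words on `Z ⊔ {⋆}` with exactly one occurrence of `⋆`.
Such a word is `⋆ w`, `z q`, `⌊q⌋ w` or `⌊u⌋ q`, with `w, u ∈ 𝔐(Z)`, `z ∈ Z`, and `q` again a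
`⋆`-bracketed word. -/
inductive StarWord (Z : Type u) : Type u
  | star (w : BW Z) : StarWord Z
  | consVar (z : Z) (q : StarWord Z) : StarWord Z
  | brStar (q : StarWord Z) (w : BW Z) : StarWord Z
  | consBr (u : BW Z) (q : StarWord Z) : StarWord Z

/-- `q.subst u` is `q|_u`, the word obtained from `q` by replacing `⋆` by the word `u`. -/
def StarWord.subst {Z : Type u} : StarWord Z → BW Z → BW Z
  | star w, s => s * w
  | consVar z q, s => BW.consVar z (q.subst s)
  | brStar q w, s => BW.consBr (q.subst s) w
  | consBr u q, s => BW.consBr u (q.subst s)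

/-! ### Words in Rota-Baxter normal form -/

namespace BW

variable {Z : Type u}

/-- A word is in Rota-Baxter normal form if it has no subword of the form `⌊u⌋⌊v⌋`. -/
def IsRBNF (w : BW Z) : Prop :=
  ¬ ∃ (q : StarWord Z) (u v : BW Z), w = q.subst (br u * br v)

/-- The word begins with a bracket. -/
def StartsBr : BW Z → Prop
  | consBr _ _ => True
  | _ => False

/-- Recursive description of the words in Rota-Baxter normal form (see `isRBNF_iff`). -/
def RBNFRec : BW Z → Prop
  | one => True
  | consVar _ w => RBNFRec w
  | consBr u w => RBNFRec u ∧ RBNFRec w ∧ ¬ StartsBr w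

theorem one_mul' (v : BW Z) : (one : BW Z) * v = v := rfl
theorem consVar_mul (z : Z) (w v : BW Z) : consVar z w * v = consVar z (w * v) := rfl
theorem consBr_mul (u w v : BW Z) : consBr u w * v = consBr u (w * v) := rfl
theorem br_mul (u v : BW Z) : br u * v = consBr u v := rfl

theorem isRBNF_iff (w : BW Z) : w.IsRBNF ↔ w.RBNFRec := by
  constructor
  · intro h
    induction w with
    | one => trivial
    | consVar z w ih =>
      exact ih fun ⟨q, a, b, e⟩ => h ⟨.consVar z q, a, b, by rw [e]; rfl⟩
    | consBr u w ihu ihw =>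
      refine ⟨ihu fun ⟨q, a, b, e⟩ => h ⟨.brStar q w, a, b, by rw [e]; rfl⟩,
        ihw fun ⟨q, a, b, e⟩ => h ⟨.consBr u q, a, b, by rw [e]; rfl⟩, ?_⟩
      intro hs
      cases w with
      | one => exact hs
      | consVar z w => exact hs
      | consBr b w => exact h ⟨.star w, u, b, rfl⟩
  · rintro h ⟨q, a, b, rfl⟩
    induction q with
    | star w => exact h.2.2 trivial
    | consVar z q ih => exact ih h
    | brStar q w ih => exact ih h.1
    | consBr u q ih => exact ih h.2.1

theorem IsRBNF.one : (1 : BW Z).IsRBNF := (isRBNF_iff _).2 trivial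

theorem IsRBNF.var (z : Z) : (var z).IsRBNF := (isRBNF_iff _).2 trivial

theorem IsRBNF.br {u : BW Z} (h : u.IsRBNF) : (br u).IsRBNF :=
  (isRBNF_iff _).2 ⟨(isRBNF_iff _).1 h, trivial, id⟩

/-- If `a ⌊s⌋` and `⌊t⌋ b` are in normal form, then so is `a ⌊m⌋ b` for `m` in normal form. -/
theorem IsRBNF.glue {a s t b m : BW Z} (h₁ : (a * BW.br s).IsRBNF) (h₂ : (BW.br t * b).IsRBNF)
    (hm : m.IsRBNF) : (a * BW.br m * b).IsRBNF := by
  rw [isRBNF_iff] at *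
  induction a with
  | one => exact ⟨hm, h₂.2⟩
  | consVar z w ih => exact ih h₁
  | consBr u w _ ih =>
    refine ⟨h₁.1, ih h₁.2.1, ?_⟩
    cases w with
    | one => exact absurd trivial h₁.2.2
    | consVar z w => exact id
    | consBr u w => exact absurd trivial h₁.2.2

/-- If `u` and `v` are in normal form and it is not the case that `u` ends and `v` begins with a
bracket, then `u v` is in normal form. -/
theorem IsRBNF.mul {u v : BW Z} (hu : u.IsRBNF) (hv : v.IsRBNF)
    (h : ¬ ∃ a s t b : BW Z, u = a * BW.br s ∧ v = BW.br t * b) : (u * v).IsRBNF := by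
  rw [isRBNF_iff] at *
  induction u with
  | one => exact hv
  | consVar z w ih =>
    exact ih hu fun ⟨a, s, t, b, e, e'⟩ => h ⟨.consVar z a, s, t, b, by rw [e]; rfl, e'⟩
  | consBr x w _ ih =>
    refine ⟨hu.1,
      ih hu.2.1 fun ⟨a, s, t, b, e, e'⟩ => h ⟨.consBr x a, s, t, b, by rw [e]; rfl, e'⟩, ?_⟩
    cases w with
    | one =>
      cases v with
      | one => exact id
      | consVar z v => exact id
      | consBr y v => exact fun _ => h ⟨.one, x, y, v, rfl, rfl⟩
    | consVar z w => exact id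
    | consBr y w => exact absurd trivial hu.2.2

end BW

/-- The set `ℜ(Z)` of bracketed words on `Z` in Rota-Baxter normal form. -/
def RBW (Z : Type u) : Type u := {w : BW Z // w.IsRBNF}

/-! ### The free operated algebra, evaluation, `φ`-algebras -/

noncomputable section

/-- The free operated algebra `k⟨⟨Z⟩⟩ = k𝔐(Z)` (its operator is `op`). -/
abbrev FreeOp (k : Type u) (Z : Type v) [CommRing k] : Type (max u v) := MonoidAlgebra k (BW Z)

/-- A bracketed word as an element of `k𝔐(Z)`. -/
def mon (k : Type u) {Z : Type v} [CommRing k] (w : BW Z) : FreeOp k Z := MonoidAlgebra.single w 1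

/-- The set of bracketed words appearing in `f` with a non-zero coefficient. -/
def supp {k : Type u} {Z : Type v} [CommRing k] (f : FreeOp k Z) : Finset (BW Z) := f.coeff.support

/-- The linear extension to `k𝔐(Z)` of a map defined on bracketed words. -/
def linExt {k : Type u} {Z : Type v} [CommRing k] {A : Type w} [AddCommGroup A] [Module k A]
    (g : BW Z → A) : FreeOp k Z →ₗ[k] A :=
  Finsupp.linearCombination k g ∘ₗ (MonoidAlgebra.coeffLinearEquiv k).toLinearMap

/-- The operator `⌊ ⌋` on `k𝔐(Z)`, the linear extension of the bracket operator on words. -/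
def op (k : Type u) (Z : Type v) [CommRing k] : FreeOp k Z →ₗ[k] FreeOp k Z :=
  linExt fun w => mon k w.br

/-- Evaluation of a word in an operated algebra `(R, P)` at the point `r`. -/
def evalWord {k : Type u} [CommRing k] {X : Type v} {R : Type w} [Ring R] [Algebra k R]
    (P : R →ₗ[k] R) (r : X → R) : BW X → R
  | .one => 1
  | .consVar x w => r x * evalWord P r w
  | .consBr u w => P (evalWord P r u) * evalWord P r w

/-- Evaluation `f_{(R, P)}(r)` of an operated polynomial `f`, for `r : X → R`: the value at `f`
of the morphism of operated algebras `k𝔐(X) → R` that extends `r`. -/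
def eval {k : Type u} [CommRing k] {X : Type v} {R : Type w} [Ring R] [Algebra k R]
    (P : R →ₗ[k] R) (r : X → R) : FreeOp k X →ₗ[k] R :=
  linExt (evalWord P r)

section

variable {k : Type u} [CommRing k]

/-- `(R, P)` is a `φ`-algebra, where `φ = φ(x, y)`. -/
def IsPhiAlgebra (φ : FreeOp k (Fin 2)) {R : Type w} [Ring R] [Algebra k R]
    (P : R →ₗ[k] R) : Prop :=
  ∀ r : Fin 2 → R, eval P r φ = 0

/-- The value `B(f, g)` of an operated polynomial `B(x, y)` at `f, g ∈ k𝔐(Z)`. -/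
def subst₂ {Z : Type v} (B : FreeOp k (Fin 2)) (f g : FreeOp k Z) : FreeOp k Z :=
  eval (op k Z) ![f, g] B

/-- The operated polynomial `φ(x, y) = ⌊x⌋⌊y⌋ - ⌊B(x, y)⌋`. -/
def phi (B : FreeOp k (Fin 2)) : FreeOp k (Fin 2) :=
  mon k (BW.var 0).br * mon k (BW.var 1).br - op k (Fin 2) B

/-- Linear substitution `q|_f` of an element `f` of `k𝔐(Z)` for `⋆` in `q`. -/
def StarWord.substLin (k : Type u) [CommRing k] {Z : Type v} (q : StarWord Z) :
    FreeOp k Z →ₗ[k] FreeOp k Z :=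
  linExt fun w => mon k (q.subst w)

/-! ### Term-rewriting systems on `k𝔐(Z)` with basis `𝔐(Z)` -/

/-- One-step rewriting: for a rule `(t, v)` with `t` in the support of `f`, of coefficient `c`,
the summand `c t` of `f` is replaced by `c v`. -/
def OneStep {Z : Type v} (R : Set (BW Z × FreeOp k Z)) (f g : FreeOp k Z) : Prop :=
  ∃ (t : BW Z) (v : FreeOp k Z), (t, v) ∈ R ∧ t ∈ supp f ∧
    g = f.coeff t • v + (f - f.coeff t • mon k t)

/-- The reflexive transitive closure of one-step rewriting. -/
def Reduces {Z : Type v} (R : Set (BW Z × FreeOp k Z)) : FreeOp k Z → FreeOp k Z → Prop :=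
  Relation.ReflTransGen (OneStep R)

/-- There is no infinite chain of one-step reductions. -/
def Terminating {Z : Type v} (R : Set (BW Z × FreeOp k Z)) : Prop :=
  ¬ ∃ F : ℕ → FreeOp k Z, ∀ n, OneStep R (F n) (F (n + 1))

/-- Every fork is joinable. -/
def Confluent {Z : Type v} (R : Set (BW Z × FreeOp k Z)) : Prop :=
  ∀ f g h : FreeOp k Z, Reduces R f g → Reduces R f h →
    ∃ p : FreeOp k Z, Reduces R g p ∧ Reduces R h p

/-- Terminating and confluent. -/
def Convergent {Z : Type v} (R : Set (BW Z × FreeOp k Z)) : Prop :=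
  Terminating R ∧ Confluent R

/-- The rewriting system `Π_φ(Z)` of `φ = ⌊x⌋⌊y⌋ - ⌊B(x, y)⌋`, with the rules
`q|_{⌊u⌋⌊v⌋} → q|_{⌊B(u, v)⌋}`. -/
def rbSystem (B : FreeOp k (Fin 2)) (Z : Type v) : Set (BW Z × FreeOp k Z) :=
  {p | ∃ (q : StarWord Z) (u v : BW Z),
    p = (q.subst (u.br * v.br), q.substLin k (op k Z (subst₂ B (mon k u) (mon k v))))}

/-! ### Operated polynomial identities of Rota-Baxter type -/

/-- Every variable appears exactly once in every monomial of `B`. -/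
def TotallyLinear {X : Type v} (B : FreeOp k X) : Prop :=
  ∀ m ∈ supp B, ∀ x : X, m.count x = 1

/-- `B` is in Rota-Baxter normal form: each of its monomials is. -/
def InRBNF {X : Type v} (B : FreeOp k X) : Prop := ∀ m ∈ supp B, m.IsRBNF

/-- `φ` is of Rota-Baxter type (for sets `Z` in the universe `v`). -/
def IsRotaBaxterType (φ : FreeOp k (Fin 2)) : Prop :=
  ∃ B : FreeOp k (Fin 2), φ = phi B ∧ TotallyLinear B ∧ InRBNF B ∧
    (∀ Z : Type v, Terminating (rbSystem B Z)) ∧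
    ∀ (Z : Type v) (a b c : BW Z),
      Reduces (rbSystem B Z)
        (subst₂ B (subst₂ B (mon k a) (mon k b)) (mon k c) -
          subst₂ B (mon k a) (subst₂ B (mon k b) (mon k c))) 0

/-! ### The list of the 14 expressions -/

/-- Labels for the 14 expressions. -/
inductive Item
  | a | b | c | d | e | f | g | h | i | j | k | l | m | n

/-- The 14 expressions `B(x, y)`, depending on the constants `c` and `lam` of `k`. -/
def Item.expr (c lam : k) (t : Item) : FreeOp k (Fin 2) :=
  let x : FreeOp k (Fin 2) := mon k (BW.var 0)
  let y : FreeOp k (Fin 2) := mon k (BW.var 1)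
  let P : FreeOp k (Fin 2) →ₗ[k] FreeOp k (Fin 2) := op k (Fin 2)
  match t with
  | .a => x * P y
  | .b => P x * y
  | .c => x * P y + y * P x
  | .d => P x * y + P y * x
  | .e => x * P y + P x * y - P (x * y)
  | .f => x * P y + P x * y + lam • (x * y)
  | .g => x * P y - x * P 1 * y + lam • (x * y)
  | .h => P x * y - x * P 1 * y + lam • (x * y)
  | .i => x * P y + P x * y - x * P 1 * y + lam • (x * y)
  | .j => x * P y + P x * y - x * y * P 1 - x * P 1 * y + lam • (x * y)
  | .k => x * P y + P x * y - x * P 1 * y - P (x * y) + lam • (x * y)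
  | .l => x * P y + P x * y - x * P 1 * y - P 1 * x * y + lam • (x * y)
  | .m => c • (x * P 1 * y) + lam • (x * y)
  | .n => c • (y * P 1 * x) + lam • (y * x)

/-! ### Monomial orders and Gröbner-Shirshov bases

An order on `𝔐(Z)` is given by its strict part `lt`. -/

/-- `lt` is (the strict part of) a monomial order: a well order such that `u < v` implies
`q|_u < q|_v`. -/
structure IsMonomialOrder {Z : Type v} (lt : BW Z → BW Z → Prop) : Prop where
  wellOrder : IsWellOrder (BW Z) lt
  subst_lt : ∀ (q : StarWord Z) (u v : BW Z), lt u v → lt (q.subst u) (q.subst v)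

/-- `Π_φ(Z)` is compatible with the order: `⌊u⌋⌊v⌋` is larger than all monomials of
`⌊B(u, v)⌋`. -/
def IsCompatible (B : FreeOp k (Fin 2)) {Z : Type v} (lt : BW Z → BW Z → Prop) : Prop :=
  ∀ u v : BW Z, ∀ m ∈ supp (op k Z (subst₂ B (mon k u) (mon k v))), lt m (u.br * v.br)

/-- `w` is the leading (that is, largest) monomial of `f`. -/
def IsLeading {Z : Type v} (lt : BW Z → BW Z → Prop) (f : FreeOp k Z) (w : BW Z) : Prop :=
  w ∈ supp f ∧ ∀ m ∈ supp f, m ≠ w → lt m w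

/-- The leading monomial of `f` exists and has coefficient `1`. -/
def IsMonic {Z : Type v} (lt : BW Z → BW Z → Prop) (f : FreeOp k Z) : Prop :=
  ∃ w, IsLeading lt f w ∧ f.coeff w = 1

/-- `f` is trivial modulo `(S, w)`: a linear combination of elements `q|_s` with `s ∈ S` and
`q|_{s̄} < w`, where `s̄` is the leading monomial of `s`. -/
def IsTrivialMod {Z : Type v} (lt : BW Z → BW Z → Prop) (S : Set (FreeOp k Z)) (w : BW Z)
    (f : FreeOp k Z) : Prop :=
  f ∈ Submodule.span k {h | ∃ (q : StarWord Z) (s : FreeOp k Z) (t : BW Z),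
    s ∈ S ∧ IsLeading lt s t ∧ lt (q.subst t) w ∧ h = q.substLin k s}

/-- `S` is a Gröbner-Shirshov basis: its elements are monic, and all intersection compositions
`f μ - ν g` (with `w = f̄ μ = ν ḡ`) and all including compositions `f - q|_g`
(with `w = f̄ = q|_{ḡ}`) are trivial modulo `(S, w)`. -/
structure IsGSBasis {Z : Type v} (lt : BW Z → BW Z → Prop) (S : Set (FreeOp k Z)) : Prop where
  monic : ∀ s ∈ S, IsMonic lt s
  intersection : ∀ f ∈ S, ∀ g ∈ S, ∀ f' g' μ ν : BW Z, IsLeading lt f f' → IsLeading lt g g' →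
    f' * μ = ν * g' →
    max f'.breadth g'.breadth < (f' * μ).breadth →
    (f' * μ).breadth < f'.breadth + g'.breadth →
    IsTrivialMod lt S (f' * μ) (f * mon k μ - mon k ν * g)
  including : ∀ f ∈ S, ∀ g ∈ S, ∀ (f' g' : BW Z) (q : StarWord Z),
    IsLeading lt f f' → IsLeading lt g g' → f' = q.subst g' →
    IsTrivialMod lt S f' (f - q.substLin k g)

/-- The set `S_φ(Z)` of the elements `φ(u, v)` for bracketed words `u, v ∈ 𝔐(Z)`. -/
def monGenerators (φ : FreeOp k (Fin 2)) (Z : Type v) : Set (FreeOp k Z) :=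
  {s | ∃ u v : BW Z, s = subst₂ φ (mon k u) (mon k v)}

/-! ### The order `≤_db` -/

/-- The strict degree lexicographical order on the free monoid on `Z`. -/
def DegLexLT {Z : Type v} [LinearOrder Z] (a b : List Z) : Prop :=
  a.length < b.length ∨ (a.length = b.length ∧ List.Lex (· < ·) a b)

/-- The strict part of the order `≤_db` on `𝔐(Z)`. For `u = u₀ ⌊ũ₁⌋ u₁ ⋯ ⌊ũᵣ⌋ uᵣ` and
`v = v₀ ⌊ṽ₁⌋ v₁ ⋯ ⌊ṽₛ⌋ vₛ`, compare first the `P`-degrees, then the `P`-breadths `r` and `s`, and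
then, when `r = s`, the tuples `(ũ₁, …, ũᵣ, u₀, …, uᵣ)` and `(ṽ₁, …, ṽᵣ, v₀, …, vᵣ)`
lexicographically from the left, the brackets being compared recursively by `≤_db` and the
elements of `M(Z)` by the degree lexicographical order. -/
inductive DbLT {Z : Type v} [LinearOrder Z] : BW Z → BW Z → Prop
  | degree {u v : BW Z} (h : u.degP < v.degP) : DbLT u v
  | breadth {u v : BW Z} (hd : u.degP = v.degP) (h : u.breadthP < v.breadthP) : DbLT u v
  | bracket {u v : BW Z} (hd : u.degP = v.degP) (hb : u.breadthP = v.breadthP)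
      (p s t : List (BW Z)) (a b : BW Z) (hu : u.brackets = p ++ a :: s)
      (hv : v.brackets = p ++ b :: t) (h : DbLT a b) : DbLT u v
  | segment {u v : BW Z} (hd : u.degP = v.degP) (hb : u.brackets = v.brackets)
      (p s t : List (List Z)) (a b : List Z) (hu : u.segments = p ++ a :: s)
      (hv : v.segments = p ++ b :: t) (h : DegLexLT a b) : DbLT u v

/-! ### Free `φ`-algebras -/

/-- A `k`-submodule of `k𝔐(Z)` that is a two-sided ideal closed under the operator. -/
structure IsOperatedIdeal {Z : Type v} (I : Submodule k (FreeOp k Z)) : Prop where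
  mul_left : ∀ f g : FreeOp k Z, g ∈ I → f * g ∈ I
  mul_right : ∀ f g : FreeOp k Z, f ∈ I → f * g ∈ I
  op_mem : ∀ f ∈ I, op k Z f ∈ I

/-- The operated ideal `I_φ(Z)`: the smallest operated ideal that contains all `φ(f, g)` with
`f, g ∈ k𝔐(Z)`. -/
def phiIdeal (φ : FreeOp k (Fin 2)) (Z : Type v) : Submodule k (FreeOp k Z) :=
  sInf {I | IsOperatedIdeal I ∧ ∀ f g : FreeOp k Z, subst₂ φ f g ∈ I}

/-- The `k`-module `k𝔐(Z) / I_φ(Z)`. -/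
abbrev PhiQuot (φ : FreeOp k (Fin 2)) (Z : Type v) : Type (max u v) := FreeOp k Z ⧸ phiIdeal φ Z

/-- `(A, P)` with `i : Z → A` is the free `φ`-algebra on `Z` (tested on `φ`-algebras in the
universe `w`). -/
structure IsFreePhiAlgebra (φ : FreeOp k (Fin 2)) {Z A : Type*} [Ring A] [Algebra k A]
    (P : A →ₗ[k] A) (i : Z → A) : Prop where
  isPhiAlgebra : IsPhiAlgebra φ P
  existsUnique : ∀ (R : Type w) [Ring R] [Algebra k R] (Q : R →ₗ[k] R), IsPhiAlgebra φ Q →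
    ∀ f : Z → R, ∃! g : A →ₐ[k] R, (∀ a, g (P a) = Q (g a)) ∧ ∀ z, g (i z) = f z

/-- The bilinear multiplication `m` on the `k`-module `A` is associative with unit `e`. -/
structure IsUnitalAssoc {A : Type*} [AddCommGroup A] [Module k A] (m : A →ₗ[k] A →ₗ[k] A)
    (e : A) : Prop where
  mul_assoc : ∀ a b c, m (m a b) c = m a (m b c)
  one_mul : ∀ a, m e a = a
  mul_one : ∀ a, m a e = a

/-- The ring with the addition of `A`, multiplication `m` and unit `e`. -/
abbrev ringOf {A : Type*} [AddCommGroup A] [Module k A] {m : A →ₗ[k] A →ₗ[k] A} {e : A}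
    (h : IsUnitalAssoc m e) : Ring A :=
  { (inferInstance : AddCommGroup A) with
    mul := fun a b => m a b
    one := e
    mul_assoc := h.mul_assoc
    one_mul := h.one_mul
    mul_one := h.mul_one
    left_distrib := fun a b c => map_add (m a) b c
    right_distrib := fun a b c => by
      change m (a + b) c = m a c + m b c
      rw [map_add, LinearMap.add_apply]
    zero_mul := fun a => by
      change m 0 a = 0
      rw [map_zero, LinearMap.zero_apply]
    mul_zero := fun a => map_zero (m a) }

/-- The `k`-algebra structure on `ringOf h` with the given scalar multiplication of `A`. -/
abbrev algebraOf {A : Type*} [AddCommGroup A] [inst : Module k A] {m : A →ₗ[k] A →ₗ[k] A} {e : A}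
    (h : IsUnitalAssoc m e) : @Algebra k A _ (ringOf h).toSemiring :=
  letI := ringOf h
  @Algebra.ofModule k A _ (ringOf h).toSemiring inst
    (fun c a b => by
      change m (c • a) b = c • m a b
      rw [map_smul, LinearMap.smul_apply])
    (fun c a b => map_smul (m a) c b)

/-! ### The multiplication on `kℜ(Z)` -/

/-- The free `k`-module `kℜ(Z)` with basis `ℜ(Z)`. -/
abbrev RBSpan (k : Type u) [CommRing k] (Z : Type v) : Type (max u v) := RBW Z →₀ k

/-- The inclusion `ι : kℜ(Z) → k𝔐(Z)`. -/
def incl (k : Type u) [CommRing k] (Z : Type v) : RBSpan k Z →ₗ[k] FreeOp k Z :=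
  Finsupp.linearCombination k fun w : RBW Z => mon k w.1

/-- The operator `P_r` on `kℜ(Z)`, the linear extension of the bracket operator on `ℜ(Z)`. -/
def rbOp (k : Type u) [CommRing k] (Z : Type v) : RBSpan k Z →ₗ[k] RBSpan k Z :=
  Finsupp.linearCombination k fun w : RBW Z => Finsupp.single (⟨w.1.br, w.2.br⟩ : RBW Z) (1 : k)

open Classical in
/-- The product `u ◇ v` of two words in normal form, for a given map `red : k𝔐(Z) → kℜ(Z)`.
If `u = a ⌊s⌋` ends with a bracket and `v = ⌊t⌋ b` begins with one, then
`u ◇ v = a ⌊red (B(s, t))⌋ b`; in all other cases `u ◇ v` is the concatenation `u v`. -/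
def diamondWord (B : FreeOp k (Fin 2)) {Z : Type v} (red : FreeOp k Z →ₗ[k] RBSpan k Z)
    (u v : RBW Z) : RBSpan k Z :=
  if h : ∃ p : (BW Z × BW Z) × (BW Z × BW Z), u.1 = p.1.1 * p.1.2.br ∧ v.1 = p.2.1.br * p.2.2 then
    Finsupp.linearCombination k
      (fun m : RBW Z =>
        Finsupp.single
          (⟨h.choose.1.1 * m.1.br * h.choose.2.2,
            BW.IsRBNF.glue (h.choose_spec.1 ▸ u.2) (h.choose_spec.2 ▸ v.2) m.2⟩ : RBW Z) (1 : k))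
      (red (subst₂ B (mon k h.choose.1.2) (mon k h.choose.2.1)))
  else
    Finsupp.single
      (⟨u.1 * v.1, u.2.mul v.2 fun ⟨a, s, t, b, e⟩ => h ⟨((a, s), (t, b)), e⟩⟩ : RBW Z) 1

/-- The bilinear extension of `◇` to `kℜ(Z)`. -/
def diamond (B : FreeOp k (Fin 2)) {Z : Type v} (red : FreeOp k Z →ₗ[k] RBSpan k Z) :
    RBSpan k Z →ₗ[k] RBSpan k Z →ₗ[k] RBSpan k Z :=
  Finsupp.linearCombination k fun u : RBW Z =>
    Finsupp.linearCombination k fun v : RBW Z => diamondWord B red u v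

/-- The unit of `kℜ(Z)`: the empty word. -/
def rbOne (k : Type u) [CommRing k] (Z : Type v) : RBSpan k Z :=
  Finsupp.single (⟨1, BW.IsRBNF.one⟩ : RBW Z) 1

/-- The embedding `Z → kℜ(Z)`. -/
def rbVar (k : Type u) [CommRing k] {Z : Type v} (z : Z) : RBSpan k Z :=
  Finsupp.single (⟨BW.var z, BW.IsRBNF.var z⟩ : RBW Z) 1

/-- `(kℜ(Z), ◇, P_r)` is an associative unital operated algebra with unit the empty word, and it
is the free `φ`-algebra on `Z`, where `φ = ⌊x⌋⌊y⌋ - ⌊B(x, y)⌋`. -/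
def DiamondIsFree (B : FreeOp k (Fin 2)) (Z : Type v) (red : FreeOp k Z →ₗ[k] RBSpan k Z) : Prop :=
  ∃ h : IsUnitalAssoc (diamond B red) (rbOne k Z),
    letI := ringOf h
    letI := algebraOf h
    IsFreePhiAlgebra.{u, w} (phi B) (rbOp k Z) (rbVar k (Z := Z))

end

end

end RotaBaxterType

/-! Each of the 14 expressions is a combination of eleven basic words that are linear in `x` and in
`y` and contain at most one bracket (`IsBasic`). Hence a monomial of `⌊B(u,v)⌋` has at most as many
brackets as `⌊u⌋⌊v⌋`, and only one bracket at top level instead of two. So it is smaller for `DbLT`: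
by degree, or else by `P`-breadth (`isCompatible_dbLT`). Since `DbLT` is a monomial order, all rules
are decreasing, and termination follows by comparing supports as multisets (`wellFounded_oneStep`).

For confluence, every fork at a word `t` has to be a combination of differences of rules below `t`
(`fork_mem_dbSpan`). Forks at disjoint or nested places close because `B` is bilinear. The only
essential overlap is `⌊a⌋⌊b⌋⌊c⌋`, whose two reducts are the brackets of `B(B(a,b),c)` and
`B(a,B(b,c))` modulo smaller rules. An explicit identity writes the difference of these two as a
combination of values of `φ` (`subst₂_expr_assoc`), and counting brackets shows that the rules
involved are small enough (`isAssociative_expr`). Recursion along the order then gives a linear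
normal form map that kills all differences of rules (`exists_normalForm`), which yields confluence.

The span of the differences of rules is the ideal `I_φ(Z)` (`phiIdeal_eq_ruleSpan`), so each of its
elements reduces to `0`. A composition lies in this ideal and has monomials below `w`. Reducing it
uses only rules below `w`, for any compatible order, and this is the Gröbner-Shirshov property. The
normal form map also shows that `kℜ(Z)` is a complement of `I_φ(Z)`. Finally `◇` is the
multiplication of the quotient transported to this complement (`IsReduction.diamond_eq`), so
associativity and freeness are inherited from `k𝔐(Z)`. -/

namespace RotaBaxterType

/-! ### The order `≤_db` is a monomial order -/

namespace BW

variable {Z : Type u}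

theorem var_mul (z : Z) (w : BW Z) : var z * w = consVar z w := rfl

theorem degP_mul (u v : BW Z) : (u * v).degP = u.degP + v.degP := by
  induction u with
  | one => simp [one_mul', degP]
  | consVar z w ih => simpa [consVar_mul, degP] using ih
  | consBr x w _ ih => simp [consBr_mul, degP, ih]; omega

theorem brackets_mul (u v : BW Z) : (u * v).brackets = u.brackets ++ v.brackets := by
  induction u with
  | one => rfl
  | consVar z w ih => exact ih
  | consBr x w _ ih => simp [consBr_mul, brackets, ih]

theorem breadthP_mul (u v : BW Z) : (u * v).breadthP = u.breadthP + v.breadthP := by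
  simp [breadthP, brackets_mul]

theorem segments_consVar {z : Z} {w : BW Z} {a : List Z} {s : List (List Z)}
    (h : w.segments = a :: s) : (consVar z w).segments = (z :: a) :: s := by
  simp [segments, h]

theorem length_segments (u : BW Z) : u.segments.length = u.brackets.length + 1 := by
  induction u with
  | one => rfl
  | consVar z w ih =>
    cases h : w.segments with
    | nil => simp [h] at ih
    | cons a s => rw [segments_consVar h]; simpa [h, brackets] using ih
  | consBr x w _ ih => simp [segments, brackets, ih]

theorem exists_segments_eq_cons (u : BW Z) : ∃ a s, u.segments = a :: s := by
  cases h : u.segments with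
  | nil => simpa [h] using u.length_segments
  | cons a s => exact ⟨a, s, rfl⟩

/-- No bracket separates the two words at the junction, so the last segment of `u` and the first
segment of `v` merge. -/
theorem segments_mul {u v : BW Z} {p s : List (List Z)} {a b : List Z}
    (hu : u.segments = p ++ [a]) (hv : v.segments = b :: s) :
    (u * v).segments = p ++ (a ++ b) :: s := by
  induction u generalizing p a with
  | one =>
    cases p with
    | nil =>
      obtain rfl : [] = a := by simpa [segments] using hu
      exact hv
    | cons x p => simp [segments] at hu
  | consVar z w ih =>
    obtain ⟨c, r, h⟩ := exists_segments_eq_cons w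
    rw [segments_consVar h] at hu
    cases p with
    | nil =>
      obtain ⟨rfl, rfl⟩ : z :: c = a ∧ r = [] := by simpa using hu
      exact segments_consVar (ih (p := []) h)
    | cons x p =>
      obtain ⟨rfl, rfl⟩ : z :: c = x ∧ r = p ++ [a] := by simpa using hu
      exact segments_consVar (ih (p := c :: p) h)
  | consBr x w _ ih =>
    cases p with
    | nil =>
      have := congrArg List.length hu
      simp [segments, length_segments] at this
    | cons y p =>
      obtain ⟨rfl, h⟩ : [] = y ∧ w.segments = p ++ [a] := by simpa [segments] using hu
      simp [consBr_mul, segments, ih h]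

/-- A word is recovered by interleaving its segments with its brackets. This makes `DbLT` total. -/
theorem eq_of_brackets_segments {u v : BW Z} (hb : u.brackets = v.brackets)
    (hs : u.segments = v.segments) : u = v := by
  induction u generalizing v with
  | one =>
    cases v with
    | one => rfl
    | consVar z w =>
      obtain ⟨a, s, h⟩ := exists_segments_eq_cons w
      rw [segments_consVar h] at hs
      simp [segments] at hs
    | consBr x w => simp [brackets] at hb
  | consVar z w ih =>
    obtain ⟨a, s, h⟩ := exists_segments_eq_cons w
    rw [segments_consVar h] at hs
    cases v with
    | one => simp [segments] at hs
    | consVar y t =>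
      obtain ⟨b, r, h'⟩ := exists_segments_eq_cons t
      rw [segments_consVar h'] at hs
      simp only [List.cons.injEq] at hs
      rw [hs.1.1, ih (v := t) hb (by rw [h, h', hs.1.2, hs.2])]
    | consBr x t => simp [segments] at hs
  | consBr x w _ ih =>
    cases v with
    | one => simp [brackets] at hb
    | consVar y t =>
      obtain ⟨b, r, h'⟩ := exists_segments_eq_cons t
      rw [segments_consVar h'] at hs
      simp [segments] at hs
    | consBr y t =>
      simp only [brackets, segments, List.cons.injEq, true_and] at hb hs
      rw [hb.1, ih hb.2 hs]

/-- The recursive comparison of brackets thus descends in degree, which is what the inductions on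
`degP` for `DbLT` rely on. -/
theorem degP_lt_of_mem_brackets {u b : BW Z} (h : b ∈ u.brackets) : b.degP < u.degP := by
  induction u with
  | one => simp [brackets] at h
  | consVar z w ih => exact ih h
  | consBr x w _ ih =>
    rcases List.mem_cons.1 h with rfl | h
    · simp [degP]; omega
    · have := ih h
      simp [degP]; omega

end BW

/-! ### Lexicographic comparison of lists of equal length -/

section Lists

variable {α : Type u} {r : α → α → Prop}

theorem lex_of_append {p s t : List α} {a b : α} (h : r a b) :
    List.Lex r (p ++ a :: s) (p ++ b :: t) :=
  List.Lex.append_left r (List.Lex.rel h) p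

/-- Equal lengths exclude the case of a proper prefix, so there is a first difference. This is the
form in which the constructors of `DbLT` state a lexicographic comparison. -/
theorem exists_append_of_lex {l m : List α} (h : List.Lex r l m) (hl : l.length = m.length) :
    ∃ p s t a b, l = p ++ a :: s ∧ m = p ++ b :: t ∧ r a b := by
  induction h with
  | nil => simp at hl
  | @cons x l m _ ih =>
    obtain ⟨p, s, t, a, b, rfl, rfl, h⟩ := ih (by simpa using hl)
    exact ⟨x :: p, s, t, a, b, rfl, rfl, h⟩
  | @rel x l y m h => exact ⟨[], l, m, x, y, rfl, rfl, h⟩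

/-- Comparability is required only of the entries that occur, because for `DbLT` an induction
supplies it only for brackets of smaller degree. -/
theorem lex_trichotomy {l m : List α} (hl : l.length = m.length)
    (h : ∀ a ∈ l, ∀ b ∈ m, r a b ∨ a = b ∨ r b a) :
    List.Lex r l m ∨ l = m ∨ List.Lex r m l := by
  induction l generalizing m with
  | nil => exact .inr (.inl (List.length_eq_zero_iff.1 hl.symm).symm)
  | cons a l ih =>
    cases m with
    | nil => simp at hl
    | cons b m =>
      rcases h a (by simp) b (by simp) with h₁ | rfl | h₁
      · exact .inl (.rel h₁)
      · rcases ih (by simpa using hl)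
          (fun x hx y hy => h x (List.mem_cons_of_mem _ hx) y (List.mem_cons_of_mem _ hy))
          with h₂ | rfl | h₂
        · exact .inl (.cons h₂)
        · exact .inr (.inl rfl)
        · exact .inr (.inr (.cons h₂))
      · exact .inr (.inr (.rel h₁))

end Lists

/-! ### The degree lexicographical order -/

section DegLex

variable {Z : Type v} [LinearOrder Z]

theorem degLexLT_eq_shortlex : (DegLexLT : List Z → List Z → Prop) = List.Shortlex (· < ·) := by
  ext a b
  exact List.shortlex_def.symm

theorem DegLexLT.cons {a b : List Z} (h : DegLexLT a b) (z : Z) : DegLexLT (z :: a) (z :: b) := by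
  rcases h with h | ⟨h, h'⟩
  · exact .inl (by simpa using h)
  · exact .inr ⟨by simpa using h, .cons h'⟩

theorem DegLexLT.append {a b : List Z} (h : DegLexLT a b) (c : List Z) :
    DegLexLT (a ++ c) (b ++ c) := by
  rcases h with h | ⟨h, h'⟩
  · exact .inl (by simpa using h)
  · obtain ⟨p, s, t, x, y, rfl, rfl, hxy⟩ := exists_append_of_lex h' h
    refine .inr ⟨by simpa using h, ?_⟩
    simpa using lex_of_append hxy

theorem degLexLT_trichotomy (a b : List Z) : DegLexLT a b ∨ a = b ∨ DegLexLT b a := by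
  rw [degLexLT_eq_shortlex]
  exact trichotomous_of _ a b

end DegLex

/-! ### Totality, well-foundedness and monotonicity of `≤_db` -/

namespace DbLT

variable {Z : Type v} [LinearOrder Z]

/-- The possible reasons for an inequality, phrased with the short lexicographic order. -/
theorem cases_shortlex {u v : BW Z} (h : DbLT u v) : u.degP < v.degP ∨ u.degP = v.degP ∧
    (List.Shortlex DbLT u.brackets v.brackets ∨
      u.brackets = v.brackets ∧ List.Shortlex DegLexLT u.segments v.segments) := by
  cases h with
  | degree h => exact .inl h
  | breadth hd h => exact .inr ⟨hd, .inl (.of_length_lt h)⟩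
  | bracket hd hb p s t a b hu hv h =>
    exact .inr ⟨hd, .inl (.of_lex hb (by rw [hu, hv]; exact lex_of_append h))⟩
  | segment hd hb p s t a b hu hv h =>
    exact .inr ⟨hd, .inr ⟨hb, .of_lex (by rw [BW.length_segments, BW.length_segments, hb])
      (by rw [hu, hv]; exact lex_of_append h)⟩⟩

theorem degP_le {u v : BW Z} (h : DbLT u v) : u.degP ≤ v.degP := by
  rcases h.cases_shortlex with h | h
  · exact h.le
  · exact h.1.le

theorem trichotomy (u v : BW Z) : DbLT u v ∨ u = v ∨ DbLT v u := by
  induction hn : u.degP using Nat.strong_induction_on generalizing u v with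
  | _ n ih =>
    subst hn
    rcases lt_trichotomy u.degP v.degP with h | hd | h
    · exact .inl (.degree h)
    · rcases lt_trichotomy u.breadthP v.breadthP with h | hb | h
      · exact .inl (.breadth hd h)
      · rcases lex_trichotomy (r := DbLT) hb
          fun a ha b _ => ih a.degP (BW.degP_lt_of_mem_brackets ha) a b rfl with h | h | h
        · obtain ⟨p, s, t, a, b, hu, hv, h⟩ := exists_append_of_lex h hb
          exact .inl (.bracket hd hb p s t a b hu hv h)
        · have hs : u.segments.length = v.segments.length := by
            rw [BW.length_segments, BW.length_segments, h]
          rcases lex_trichotomy (r := DegLexLT) hs fun a _ b _ => degLexLT_trichotomy a b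
            with h' | h' | h'
          · obtain ⟨p, s, t, a, b, hu, hv, h'⟩ := exists_append_of_lex h' hs
            exact .inl (.segment hd h p s t a b hu hv h')
          · exact .inr (.inl (BW.eq_of_brackets_segments h h'))
          · obtain ⟨p, s, t, a, b, hu, hv, h'⟩ := exists_append_of_lex h' hs.symm
            exact .inr (.inr (.segment hd.symm h.symm p s t a b hu hv h'))
        · obtain ⟨p, s, t, a, b, hu, hv, h⟩ := exists_append_of_lex h hb.symm
          exact .inr (.inr (.bracket hd.symm hb.symm p s t a b hu hv h))
      · exact .inr (.inr (.breadth hd.symm h))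
    · exact .inr (.inr (.degree h))

/-- Induction on a bound for the number of brackets. For words of equal degree, the lists of
brackets and of segments decrease in a product of short lexicographic orders; comparing lengths
first accounts for the `P`-breadth. -/
theorem wellFounded [WellFoundedLT Z] : WellFounded (DbLT (Z := Z)) := by
  suffices H : ∀ n, ∀ u : BW Z, u.degP < n → Acc DbLT u from
    ⟨fun u => H _ u (Nat.lt_succ_self _)⟩
  intro n
  induction n with
  | zero => intro u h; omega
  | succ n ih =>
    -- The restriction to a larger side with fewer than `n` brackets is well-founded by induction,
    -- and it suffices because the brackets of a word with at most `n` brackets have fewer than `n`.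
    let r : BW Z → BW Z → Prop := fun a b => b.degP < n ∧ DbLT a b
    have hr : WellFounded r := by
      refine ⟨fun u => ⟨u, fun y hy => ?_⟩⟩
      have : Acc DbLT y := (ih _ hy.1).inv hy.2
      exact Subrelation.accessible (fun h => h.2) this
    have hD : WellFounded (DegLexLT : List Z → List Z → Prop) := by
      rw [degLexLT_eq_shortlex]
      exact List.Shortlex.wf wellFounded_lt
    have hwf : WellFounded (InvImage (Prod.Lex (List.Shortlex r) (List.Shortlex DegLexLT))
        fun u : BW Z => (u.brackets, u.segments)) :=
      InvImage.wf _ ((List.Shortlex.wf hr).prod_lex (List.Shortlex.wf hD))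
    intro u
    induction u using hwf.induction with
    | _ u ihu =>
      refine fun hu => ⟨u, fun y hy => ?_⟩
      rcases hy.cases_shortlex with h | ⟨hd, h | ⟨hb, h⟩⟩
      · exact ih y (by omega)
      · refine ihu y (Prod.Lex.left _ _ ?_) (by omega)
        rcases List.shortlex_def.1 h with h | ⟨hl, h⟩
        · exact .of_length_lt h
        · obtain ⟨p, s, t, a, b, h₁, h₂, h⟩ := exists_append_of_lex h hl
          refine .of_lex hl ?_
          rw [h₁, h₂]
          refine lex_of_append ⟨?_, h⟩
          have := BW.degP_lt_of_mem_brackets (u := u) (b := b) (by simp [h₂])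
          omega
      · exact ihu y (Prod.lex_def.2 (.inr ⟨hb, h⟩)) (by omega)

theorem consVar {u v : BW Z} (h : DbLT u v) (z : Z) :
    DbLT (BW.consVar z u) (BW.consVar z v) := by
  cases h with
  | degree h => exact .degree h
  | breadth hd h => exact .breadth hd h
  | bracket hd hb p s t a b hu hv h => exact .bracket hd hb p s t a b hu hv h
  | segment hd hb p s t a b hu hv h =>
    cases p with
    | nil =>
      exact .segment hd hb [] s t (z :: a) (z :: b) (BW.segments_consVar hu)
        (BW.segments_consVar hv) (h.cons z)
    | cons x p =>
      exact .segment hd hb ((z :: x) :: p) s t a b (BW.segments_consVar hu)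
        (BW.segments_consVar hv) h

theorem consBr_left {u v : BW Z} (h : DbLT u v) (w : BW Z) :
    DbLT (BW.consBr u w) (BW.consBr v w) := by
  rcases h.degP_le.lt_or_eq with hd | hd
  · exact .degree (by simp [BW.degP]; omega)
  · exact .bracket (by simp [BW.degP, hd]) (by simp [BW.breadthP, BW.brackets])
      [] w.brackets w.brackets u v rfl rfl h

theorem consBr_right {u v : BW Z} (h : DbLT u v) (w : BW Z) :
    DbLT (BW.consBr w u) (BW.consBr w v) := by
  cases h with
  | degree h => exact .degree (by simpa [BW.degP] using h)
  | breadth hd h =>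
    exact .breadth (by simp [BW.degP, hd])
      (by simpa [BW.breadthP, BW.brackets] using h)
  | bracket hd hb p s t a b hu hv h =>
    exact .bracket (by simp [BW.degP, hd]) (by simpa [BW.breadthP, BW.brackets] using hb)
      (w :: p) s t a b (by simp [BW.brackets, hu]) (by simp [BW.brackets, hv]) h
  | segment hd hb p s t a b hu hv h =>
    exact .segment (by simp [BW.degP, hd]) (by simp [BW.brackets, hb])
      ([] :: p) s t a b (by simp [BW.segments, hu]) (by simp [BW.segments, hv]) h

/-- The delicate case is a difference in the segments: multiplication by `w` prolongs the last
segment. If the first difference is there, the order on `M(Z)` must respect the common suffix;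
otherwise the change comes after the deciding place. -/
theorem mul_right {u v : BW Z} (h : DbLT u v) (w : BW Z) : DbLT (u * w) (v * w) := by
  cases h with
  | degree h => exact .degree (by simpa [BW.degP_mul] using h)
  | breadth hd h =>
    exact .breadth (by simp [BW.degP_mul, hd]) (by simpa [BW.breadthP_mul] using h)
  | bracket hd hb p s t a b hu hv h =>
    exact .bracket (by simp [BW.degP_mul, hd]) (by simp [BW.breadthP_mul, hb])
      p (s ++ w.brackets) (t ++ w.brackets) a b (by simp [BW.brackets_mul, hu])
      (by simp [BW.brackets_mul, hv]) h
  | segment hd hb p s t a b hu hv h =>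
    -- Equally many brackets force equally many segments, so the first difference is in the last
    -- segment for both words or for neither.
    have hl : s.length = t.length := by
      have h₁ := u.length_segments
      have h₂ := v.length_segments
      rw [hu] at h₁
      rw [hv] at h₂
      simp only [hb, List.length_append, List.length_cons] at h₁ h₂
      omega
    have hd' : (u * w).degP = (v * w).degP := by simp [BW.degP_mul, hd]
    have hb' : (u * w).brackets = (v * w).brackets := by simp [BW.brackets_mul, hb]
    obtain ⟨m, r, hw⟩ := BW.exists_segments_eq_cons w
    rcases List.eq_nil_or_concat' s with rfl | ⟨s, x, rfl⟩
    · obtain rfl : t = [] := List.length_eq_zero_iff.1 hl.symm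
      exact .segment hd' hb' p r r (a ++ m) (b ++ m) (BW.segments_mul hu hw)
        (BW.segments_mul hv hw) (h.append m)
    · rcases List.eq_nil_or_concat' t with rfl | ⟨t, y, rfl⟩
      · simp at hl
      · refine .segment hd' hb' p (s ++ (x ++ m) :: r) (t ++ (y ++ m) :: r) a b ?_ ?_ h
        · simpa using BW.segments_mul (p := p ++ a :: s) (a := x) (by simpa using hu) hw
        · simpa using BW.segments_mul (p := p ++ b :: t) (a := y) (by simpa using hv) hw

theorem subst {u v : BW Z} (h : DbLT u v) (q : StarWord Z) : DbLT (q.subst u) (q.subst v) := by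
  induction q with
  | star w => exact h.mul_right w
  | consVar z q ih => exact ih.consVar z
  | brStar q w ih => exact ih.consBr_left w
  | consBr w q ih => exact ih.consBr_right w

theorem isMonomialOrder [WellFoundedLT Z] : IsMonomialOrder (DbLT (Z := Z)) where
  wellOrder :=
    { wf := wellFounded
      trichotomous := fun a b h h' => by
        rcases trichotomy a b with h₁ | h₁ | h₁
        · exact absurd h₁ h
        · exact h₁
        · exact absurd h₁ h' }
  subst_lt q _ _ h := h.subst q

end DbLT

noncomputable section

/-! ### Linear extensions and supports -/

section LinExt

variable {k : Type u} [CommRing k] {Z : Type v} {A : Type w} [AddCommGroup A] [Module k A]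

theorem linExt_mon (g : BW Z → A) (w : BW Z) : linExt (k := k) g (mon k w) = g w := by
  simp [linExt, mon]

theorem linExt_eq_sum (g : BW Z → A) (f : FreeOp k Z) :
    linExt g f = ∑ m ∈ supp f, f.coeff m • g m := by
  simp [linExt, supp, Finsupp.linearCombination_apply, Finsupp.sum]

theorem linExt_congr {g g' : BW Z → A} {f : FreeOp k Z} (h : ∀ m ∈ supp f, g m = g' m) :
    linExt g f = linExt g' f := by
  rw [linExt_eq_sum, linExt_eq_sum]
  exact Finset.sum_congr rfl fun m hm => by rw [h m hm]

theorem eq_sum_mon (f : FreeOp k Z) : f = ∑ m ∈ supp f, f.coeff m • mon k m := by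
  rw [← linExt_eq_sum]
  have : linExt (mon k) = (LinearMap.id : FreeOp k Z →ₗ[k] FreeOp k Z) := by
    ext w
    simp [linExt, mon]
  rw [this, LinearMap.id_apply]

theorem linearMap_ext_mon {f g : FreeOp k Z →ₗ[k] A} (h : ∀ w, f (mon k w) = g (mon k w)) :
    f = g := by
  refine LinearMap.ext fun f' => ?_
  rw [eq_sum_mon f']
  simp [h]

/-- The submodule of elements all of whose monomials satisfy `p`. -/
def suppIn (k : Type u) [CommRing k] {Z : Type v} (p : BW Z → Prop) : Submodule k (FreeOp k Z) :=
  MonoidAlgebra.supported k k {w | p w}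

theorem mem_suppIn {p : BW Z → Prop} {f : FreeOp k Z} : f ∈ suppIn k p ↔ ∀ m ∈ supp f, p m :=
  Iff.rfl

theorem mon_mem_suppIn {p : BW Z → Prop} {w : BW Z} (h : p w) : mon k w ∈ suppIn k p := by
  rw [suppIn, MonoidAlgebra.supported_eq_span_single]
  exact Submodule.subset_span ⟨w, h, rfl⟩

theorem suppIn_mono {p q : BW Z → Prop} (h : ∀ w, p w → q w) : suppIn k p ≤ suppIn k q :=
  MonoidAlgebra.supported_mono h

/-- To show that a linear map sends `suppIn k p` to a submodule, consider only monomials. -/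
theorem suppIn_le_comap {p : BW Z → Prop} {T : FreeOp k Z →ₗ[k] A} {M : Submodule k A}
    (h : ∀ w, p w → T (mon k w) ∈ M) : suppIn k p ≤ M.comap T := by
  intro f hf
  rw [Submodule.mem_comap, eq_sum_mon f, map_sum]
  exact Submodule.sum_mem _ fun m hm => by
    rw [map_smul]
    exact M.smul_mem _ (h m (hf hm))

theorem coeff_eq_zero_of_mem_suppIn {p : BW Z → Prop} {f : FreeOp k Z} (hf : f ∈ suppIn k p)
    {w : BW Z} (hw : ¬ p w) : f.coeff w = 0 := by
  by_contra h
  exact hw (hf (Finsupp.mem_support_iff.2 h))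

theorem coeff_mon_self (w : BW Z) : (mon k w).coeff w = 1 := by
  simp [mon]

end LinExt

/-! ### Rewriting systems with decreasing rules -/

section Rewriting

variable {k : Type u} [CommRing k] {Z : Type v} {lt : BW Z → BW Z → Prop}
  {R : Set (BW Z × FreeOp k Z)}

/-- The span of the elements `t - v`, for the rules `t → v` whose left-hand side satisfies `p`. -/
def ruleSpan (R : Set (BW Z × FreeOp k Z)) (p : BW Z → Prop) : Submodule k (FreeOp k Z) :=
  Submodule.span k {h | ∃ t v, (t, v) ∈ R ∧ p t ∧ h = mon k t - v}

theorem rule_mem_ruleSpan {p : BW Z → Prop} {t : BW Z} {v : FreeOp k Z} (h : (t, v) ∈ R)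
    (ht : p t) : mon k t - v ∈ ruleSpan R p :=
  Submodule.subset_span ⟨t, v, h, ht, rfl⟩

theorem ruleSpan_mono {p q : BW Z → Prop} (h : ∀ w, p w → q w) :
    ruleSpan R p ≤ ruleSpan R q :=
  Submodule.span_mono fun _ ⟨t, v, hR, ht, e⟩ => ⟨t, v, hR, h t ht, e⟩

/-- The right-hand side of every rule consists of monomials smaller than the left-hand side. -/
def Decreasing (lt : BW Z → BW Z → Prop) (R : Set (BW Z × FreeOp k Z)) : Prop :=
  ∀ t v, (t, v) ∈ R → ∀ m ∈ supp v, lt m t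

/-- No rule applies to the word `t`. -/
def Irred (R : Set (BW Z × FreeOp k Z)) (t : BW Z) : Prop := ¬ ∃ v, (t, v) ∈ R

/-- A step removes the monomial `t` from the support and can only add monomials below `t`, so the
support decreases in the Dershowitz-Manna order on finite multisets. -/
theorem wellFounded_oneStep (wo : IsWellOrder (BW Z) lt) (hR : Decreasing lt R) :
    WellFounded fun g f => OneStep R f g := by
  classical
  let _ : Preorder (BW Z) :=
    { le := fun a b => lt a b ∨ a = b
      lt := lt
      le_refl := fun a => .inr rfl
      le_trans := by
        rintro a b c (h | rfl) (h' | rfl)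
        · exact .inl (trans_of lt h h')
        · exact .inl h
        · exact .inl h'
        · exact .inr rfl
      lt_iff_le_not_ge := fun a b => by
        refine ⟨fun h => ⟨.inl h, ?_⟩, ?_⟩
        · rintro (h' | rfl)
          · exact asymm_of lt h h'
          · exact irrefl_of lt _ h
        · rintro ⟨h | rfl, h'⟩
          · exact h
          · exact absurd (.inr rfl) h' }
  have : WellFoundedLT (BW Z) := ⟨wo.wf⟩
  refine Subrelation.wf ?_
    (InvImage.wf (fun f : FreeOp k Z => (supp f).val) Multiset.wellFounded_isDershowitzMannaLT)
  rintro g f ⟨t, v, h, ht, rfl⟩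
  set g := f.coeff t • v + (f - f.coeff t • mon k t) with hg
  -- All monomials of `v` are strictly below `t`, so `t` cannot come back through `v`.
  have hvt : v.coeff t = 0 := coeff_eq_zero_of_mem_suppIn (p := (lt · t)) (hR t v h)
    (irrefl_of lt t)
  have hgt : t ∉ supp g := by
    simp [supp, hg, hvt, coeff_mon_self]
  have hgv : ∀ m ∈ supp g \ supp f, lt m t := by
    intro m hm
    rw [Finset.mem_sdiff] at hm
    have hmf : f.coeff m = 0 := by simpa [supp] using hm.2
    have hmt : t ≠ m := fun e => hgt (e ▸ hm.1)
    refine hR t v h m (Finsupp.mem_support_iff.2 fun hv => ?_)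
    refine Finsupp.mem_support_iff.1 hm.1 ?_
    simp [hg, hv, hmf, mon, Finsupp.single_eq_of_ne' hmt]
  -- The common, added and removed parts. Cancellation may remove more than `t`, but `t` alone
  -- dominates everything added.
  refine ⟨(supp f ∩ supp g).val, (supp g \ supp f).val, (supp f \ supp g).val, ?_, ?_, ?_, ?_⟩
  · intro h0
    have : t ∈ (supp f \ supp g).val := Finset.mem_sdiff.2 ⟨ht, hgt⟩
    simp [h0] at this
  · have := Finset.disjoint_sdiff_inter (supp g) (supp f)
    rw [Finset.inter_comm, ← Finset.disjUnion_val _ _ this.symm, Finset.disjUnion_eq_union,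
      Finset.union_comm, Finset.sdiff_union_inter]
  · have := Finset.disjoint_sdiff_inter (supp f) (supp g)
    rw [← Finset.disjUnion_val _ _ this.symm, Finset.disjUnion_eq_union, Finset.union_comm,
      Finset.sdiff_union_inter]
  · exact fun y hy => ⟨t, Finset.mem_sdiff.2 ⟨ht, hgt⟩, hgv y hy⟩

theorem terminating_of_wellFounded (h : WellFounded fun g f => OneStep R f g) :
    Terminating R := by
  rintro ⟨F, hF⟩
  exact (wellFounded_iff_isEmpty_descending_chain.1 h).false ⟨F, hF⟩

theorem exists_reduces_irred (h : WellFounded fun g f => OneStep R f g) (f : FreeOp k Z) :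
    ∃ g, Reduces R f g ∧ g ∈ suppIn k (Irred R) := by
  induction f using h.induction with
  | _ f ih =>
    by_cases hf : f ∈ suppIn k (Irred R)
    · exact ⟨f, .refl, hf⟩
    · simp only [mem_suppIn, not_forall, Irred, not_not] at hf
      obtain ⟨t, ht, v, hv⟩ := hf
      obtain ⟨g, hg, hg'⟩ := ih _ ⟨t, v, hv, ht, rfl⟩
      exact ⟨g, .head ⟨t, v, hv, ht, rfl⟩ hg, hg'⟩

theorem OneStep.sub_mem_ruleSpan {f g : FreeOp k Z} (h : OneStep R f g) :
    f - g ∈ ruleSpan R fun _ => True := by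
  obtain ⟨t, v, h, -, rfl⟩ := h
  have : f - (f.coeff t • v + (f - f.coeff t • mon k t)) = f.coeff t • (mon k t - v) := by
    rw [smul_sub]; abel
  rw [this]
  exact Submodule.smul_mem _ _ (rule_mem_ruleSpan h trivial)

theorem Reduces.sub_mem_ruleSpan {f g : FreeOp k Z} (h : Reduces R f g) :
    f - g ∈ ruleSpan R fun _ => True := by
  induction h with
  | refl => simp
  | tail _ h ih => simpa using add_mem ih h.sub_mem_ruleSpan

/-- Reductions do not leave the elements with monomials below `w`, and can be expressed by rules
with left-hand sides below `w`. -/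
theorem Reduces.mem_ruleSpan_lt (wo : IsWellOrder (BW Z) lt) (hR : Decreasing lt R) {w : BW Z}
    {f : FreeOp k Z} (h : Reduces R f 0) (hf : f ∈ suppIn k (lt · w)) :
    f ∈ ruleSpan R (lt · w) := by
  induction h using Relation.ReflTransGen.head_induction_on with
  | refl => exact zero_mem _
  | @head f g h _ ih =>
    obtain ⟨t, v, h, ht, rfl⟩ := h
    have htw : lt t w := hf ht
    have hv : v ∈ suppIn k (lt · w) := fun m hm => trans_of lt (hR t v h m hm) htw
    have := ih (add_mem (Submodule.smul_mem _ _ hv)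
      (sub_mem hf (Submodule.smul_mem _ _ (mon_mem_suppIn htw))))
    have e : f = f.coeff t • (mon k t - v) + (f.coeff t • v + (f - f.coeff t • mon k t)) := by
      rw [smul_sub]; abel
    rw [e]
    exact add_mem (Submodule.smul_mem _ _ (rule_mem_ruleSpan h htw)) this

/-- A linear map that annihilates all differences `t - v`, for rules `t → v`, and fixes the
irreducible elements. -/
structure IsNormalFormMap (R : Set (BW Z × FreeOp k Z)) (N : FreeOp k Z →ₗ[k] FreeOp k Z) :
    Prop where
  map_eq_zero : ∀ f ∈ ruleSpan R fun _ => True, N f = 0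
  map_irred : ∀ f ∈ suppIn k (Irred R), N f = f

/-- If all forks at a monomial are trivial, there is a linear normal form map. -/
theorem exists_normalForm (wo : IsWellOrder (BW Z) lt) (hR : Decreasing lt R)
    (hc : ∀ t v v', (t, v) ∈ R → (t, v') ∈ R → v - v' ∈ ruleSpan R (lt · t)) :
    ∃ N : FreeOp k Z →ₗ[k] FreeOp k Z, IsNormalFormMap R N := by
  classical
  -- Recursion along the order with one chosen rule at each reducible word. The default `0` is never
  -- reached, since rules are decreasing.
  let F (t : BW Z) (ih : ∀ m, lt m t → FreeOp k Z) : FreeOp k Z :=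
    if h : ∃ v, (t, v) ∈ R then
      linExt (fun m => if hm : lt m t then ih m hm else 0) h.choose
    else mon k t
  let nf : BW Z → FreeOp k Z := wo.wf.fix F
  have hirr (t : BW Z) (ht : Irred R t) : nf t = mon k t := by
    rw [show nf t = F t fun m _ => nf m from wo.wf.fix_eq F t]
    exact dif_neg ht
  have hred (t : BW Z) (h : ∃ v, (t, v) ∈ R) : nf t = linExt nf h.choose := by
    rw [show nf t = F t fun m _ => nf m from wo.wf.fix_eq F t]
    refine (dif_pos h).trans (linExt_congr fun m hm => ?_)
    rw [dif_pos (hR t _ h.choose_spec m hm)]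
  -- Independence of the chosen rule: two right-hand sides differ by a combination of rules below
  -- `t`, which `linExt nf` kills by induction.
  have key (t : BW Z) : ∀ v, (t, v) ∈ R → nf t = linExt nf v := by
    induction t using wo.wf.induction with
    | _ t ih =>
      intro v hv
      have h : ∃ v, (t, v) ∈ R := ⟨v, hv⟩
      rw [hred t h, ← sub_eq_zero, ← map_sub]
      have : ruleSpan R (lt · t) ≤ LinearMap.ker (linExt (k := k) nf) := by
        refine Submodule.span_le.2 ?_
        rintro _ ⟨s, u, hs, hst, rfl⟩
        simp [linExt_mon, ih s hst u hs]
      exact this (hc t _ _ h.choose_spec hv)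
  refine ⟨linExt nf, fun f hf => ?_, fun f hf => ?_⟩
  · have : (ruleSpan R fun _ => True) ≤ LinearMap.ker (linExt (k := k) nf) := by
      refine Submodule.span_le.2 ?_
      rintro _ ⟨s, u, hs, -, rfl⟩
      simp [linExt_mon, key s u hs]
    exact this hf
  · exact (linExt_congr fun m hm => hirr m (hf hm)).trans
      ((linExt_eq_sum _ _).trans (eq_sum_mon f).symm)

theorem IsNormalFormMap.eq_of_reduces {N : FreeOp k Z →ₗ[k] FreeOp k Z} (hN : IsNormalFormMap R N)
    {f g : FreeOp k Z} (h : Reduces R f g) : N f = N g := by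
  rw [← sub_eq_zero, ← map_sub]
  exact hN.map_eq_zero _ h.sub_mem_ruleSpan

/-- `N` is constant along reductions and fixes irreducible elements, so any irreducible reduct of
`f` equals `N f`. -/
theorem IsNormalFormMap.reduces {N : FreeOp k Z →ₗ[k] FreeOp k Z} (hN : IsNormalFormMap R N)
    (hwf : WellFounded fun g f => OneStep R f g) (f : FreeOp k Z) :
    Reduces R f (N f) ∧ N f ∈ suppIn k (Irred R) := by
  obtain ⟨g, hg, hg'⟩ := exists_reduces_irred hwf f
  rw [hN.eq_of_reduces hg, hN.map_irred g hg']
  exact ⟨hg, hg'⟩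

theorem IsNormalFormMap.confluent {N : FreeOp k Z →ₗ[k] FreeOp k Z} (hN : IsNormalFormMap R N)
    (hwf : WellFounded fun g f => OneStep R f g) : Confluent R := by
  intro f g h hg hh
  refine ⟨N f, ?_, ?_⟩
  · rw [hN.eq_of_reduces hg]
    exact (hN.reduces hwf g).1
  · rw [hN.eq_of_reduces hh]
    exact (hN.reduces hwf h).1

theorem IsNormalFormMap.reduces_zero {N : FreeOp k Z →ₗ[k] FreeOp k Z} (hN : IsNormalFormMap R N)
    (hwf : WellFounded fun g f => OneStep R f g) {f : FreeOp k Z}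
    (hf : f ∈ ruleSpan R fun _ => True) : Reduces R f 0 := by
  simpa [hN.map_eq_zero f hf] using (hN.reduces hwf f).1

end Rewriting

/-! ### Monomials, evaluation and substitution -/

section Eval

variable {k : Type u} [CommRing k]

theorem mon_mul_mon {Z : Type v} (a b : BW Z) : mon k a * mon k b = mon k (a * b) := by
  simp [mon, MonoidAlgebra.single_mul_single]

theorem mon_one {Z : Type v} : mon k (1 : BW Z) = 1 := rfl

theorem op_mon {Z : Type v} (a : BW Z) : op k Z (mon k a) = mon k a.br := linExt_mon _ _

variable {X : Type v} {R : Type w} [Ring R] [Algebra k R] (P : R →ₗ[k] R) (r : X → R)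

theorem evalWord_mul (a b : BW X) : evalWord P r (a * b) = evalWord P r a * evalWord P r b := by
  induction a with
  | one => simp [BW.one_mul', evalWord]
  | consVar z w ih => simp [BW.consVar_mul, evalWord, ih, mul_assoc]
  | consBr x w _ ih => simp [BW.consBr_mul, evalWord, ih, mul_assoc]

theorem evalWord_one : evalWord P r 1 = 1 := rfl

theorem evalWord_var (x : X) : evalWord P r (BW.var x) = r x := by simp [BW.var, evalWord]

theorem evalWord_br (a : BW X) : evalWord P r a.br = P (evalWord P r a) := by
  simp [BW.br, evalWord]

theorem eval_mon (a : BW X) : eval P r (mon k a) = evalWord P r a := linExt_mon _ _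

theorem eval_one : eval P r (1 : FreeOp k X) = 1 := eval_mon P r 1

theorem eval_mul (f g : FreeOp k X) : eval P r (f * g) = eval P r f * eval P r g := by
  have h : (LinearMap.mul k (FreeOp k X)).compr₂ (eval P r) =
      (LinearMap.mul k R).compl₁₂ (eval P r) (eval P r) := by
    refine linearMap_ext_mon fun a => linearMap_ext_mon fun b => ?_
    simp [mon_mul_mon, eval_mon, evalWord_mul]
  exact congr($h f g)

theorem eval_op (f : FreeOp k X) : eval P r (op k X f) = P (eval P r f) := by
  have h : eval P r ∘ₗ op k X = P ∘ₗ eval P r := by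
    refine linearMap_ext_mon fun a => ?_
    simp [op_mon, eval_mon, evalWord_br]
  exact congr($h f)

/-- Evaluation as a morphism of algebras. -/
def evalHom : FreeOp k X →ₐ[k] R :=
  AlgHom.ofLinearMap (eval P r) (eval_one P r) (eval_mul P r)

/-- Morphisms of operated algebras commute with evaluation. -/
theorem map_eval {S : Type*} [Ring S] [Algebra k S] {Q : S →ₗ[k] S} (h : R →ₐ[k] S)
    (hQ : ∀ a, h (P a) = Q (h a)) (f : FreeOp k X) :
    h (eval P r f) = eval Q (fun x => h (r x)) f := by
  have e : h.toLinearMap ∘ₗ eval P r = eval Q (fun x => h (r x)) := by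
    refine linearMap_ext_mon fun a => ?_
    induction a with
    | one => simp [eval_mon, evalWord]
    | consVar z w ih => simpa [eval_mon, evalWord] using congr(_ * $ih)
    | consBr x w ihx ih =>
      simp only [LinearMap.comp_apply, AlgHom.toLinearMap_apply, eval_mon] at ihx ih
      simp [eval_mon, evalWord, hQ, ihx, ih]
  exact congr($e f)

theorem eval_phi (B : FreeOp k (Fin 2)) (r : Fin 2 → R) :
    eval P r (phi B) = P (r 0) * P (r 1) - P (eval P r B) := by
  simp [phi, eval_mul, eval_mon, evalWord_br, evalWord_var, eval_op]

end Eval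

theorem subst₂_phi {k : Type u} [CommRing k] {Z : Type v} (B : FreeOp k (Fin 2))
    (f g : FreeOp k Z) :
    subst₂ (phi B) f g = op k Z f * op k Z g - op k Z (subst₂ B f g) :=
  eval_phi _ _ _

/-! ### Operations on `⋆`-bracketed words and their linear substitutions -/

namespace StarWord

variable {Z : Type v}

/-- The `⋆`-bracketed word `q w`. -/
def mulRight : StarWord Z → BW Z → StarWord Z
  | star a, w => star (a * w)
  | consVar z q, w => consVar z (q.mulRight w)
  | brStar q a, w => brStar q (a * w)
  | consBr u q, w => consBr u (q.mulRight w)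

/-- The `⋆`-bracketed word `w q`. -/
def mulLeft : BW Z → StarWord Z → StarWord Z
  | .one, q => q
  | .consVar z w, q => consVar z (mulLeft w q)
  | .consBr u w, q => consBr u (mulLeft w q)

/-- The `⋆`-bracketed word `q|_p`. -/
def comp : StarWord Z → StarWord Z → StarWord Z
  | star a, p => p.mulRight a
  | consVar z q, p => consVar z (q.comp p)
  | brStar q a, p => brStar (q.comp p) a
  | consBr u q, p => consBr u (q.comp p)

theorem subst_mulRight (q : StarWord Z) (w s : BW Z) :
    (q.mulRight w).subst s = q.subst s * w := by
  induction q with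
  | star a => exact (mul_assoc s a w).symm
  | consVar z q ih => exact congrArg _ ih
  | brStar q a => rfl
  | consBr u q ih => exact congrArg _ ih

theorem subst_mulLeft (q : StarWord Z) (w s : BW Z) :
    (mulLeft w q).subst s = w * q.subst s := by
  induction w with
  | one => rfl
  | consVar z w ih => exact congrArg _ ih
  | consBr u w _ ih => exact congrArg _ ih

theorem subst_comp (q p : StarWord Z) (s : BW Z) : (q.comp p).subst s = q.subst (p.subst s) := by
  induction q with
  | star a => exact subst_mulRight p a s
  | consVar z q ih => exact congrArg _ ih
  | brStar q a ih => exact congrArg (BW.consBr · a) ih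
  | consBr u q ih => exact congrArg _ ih

variable (k : Type u) [CommRing k]

theorem substLin_mon (q : StarWord Z) (w : BW Z) : q.substLin k (mon k w) = mon k (q.subst w) :=
  linExt_mon _ _

theorem substLin_comp (q p : StarWord Z) (f : FreeOp k Z) :
    (q.comp p).substLin k f = q.substLin k (p.substLin k f) := by
  have : (q.comp p).substLin k = q.substLin k ∘ₗ p.substLin k :=
    linearMap_ext_mon fun w => by simp [substLin_mon, subst_comp]
  exact congr($this f)

theorem substLin_star (w : BW Z) (f : FreeOp k Z) : (star w).substLin k f = f * mon k w := by
  have : (star w).substLin k = (LinearMap.mul k (FreeOp k Z)).flip (mon k w) :=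
    linearMap_ext_mon fun a => by simp [substLin_mon, subst, mon_mul_mon]
  exact congr($this f)

theorem substLin_consVar (z : Z) (q : StarWord Z) (f : FreeOp k Z) :
    (consVar z q).substLin k f = mon k (BW.var z) * q.substLin k f := by
  have : (consVar z q).substLin k = LinearMap.mulLeft k (mon k (BW.var z)) ∘ₗ q.substLin k :=
    linearMap_ext_mon fun a => by
      simp [substLin_mon, subst, mon_mul_mon, BW.var_mul]
  exact congr($this f)

theorem substLin_brStar (q : StarWord Z) (w : BW Z) (f : FreeOp k Z) :
    (brStar q w).substLin k f = op k Z (q.substLin k f) * mon k w := by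
  have : (brStar q w).substLin k =
      (LinearMap.mul k (FreeOp k Z)).flip (mon k w) ∘ₗ op k Z ∘ₗ q.substLin k :=
    linearMap_ext_mon fun a => by simp [substLin_mon, subst, mon_mul_mon, op_mon, BW.br_mul]
  exact congr($this f)

theorem substLin_consBr (u : BW Z) (q : StarWord Z) (f : FreeOp k Z) :
    (consBr u q).substLin k f = mon k u.br * q.substLin k f := by
  have : (consBr u q).substLin k = LinearMap.mulLeft k (mon k u.br) ∘ₗ q.substLin k :=
    linearMap_ext_mon fun a => by simp [substLin_mon, subst, mon_mul_mon, BW.br_mul]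
  exact congr($this f)

/-- Together with `substLin_star`, this makes facts about substitution apply to multiplication by
words on either side. -/
theorem substLin_mulLeft_star (u : BW Z) (f : FreeOp k Z) :
    (mulLeft u (star 1)).substLin k f = mon k u * f := by
  have : (mulLeft u (star 1)).substLin k = LinearMap.mulLeft k (mon k u) :=
    linearMap_ext_mon fun a => by simp [substLin_mon, subst_mulLeft, subst, mon_mul_mon]
  exact congr($this f)

end StarWord

/-! ### Rules of the rewriting system -/

section Rules

variable {k : Type u} [CommRing k] {Z : Type v} {B : FreeOp k (Fin 2)}

/-- The right-hand side `⌊B(u, v)⌋` of the rule for `⌊u⌋⌊v⌋`. -/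
abbrev rhs (B : FreeOp k (Fin 2)) (u v : BW Z) : FreeOp k Z :=
  op k Z (subst₂ B (mon k u) (mon k v))

theorem subst_mem_rbSystem {t : BW Z} {v : FreeOp k Z} (h : (t, v) ∈ rbSystem B Z)
    (q : StarWord Z) : (q.subst t, q.substLin k v) ∈ rbSystem B Z := by
  obtain ⟨p, a, b, e⟩ := h
  obtain ⟨rfl, rfl⟩ := Prod.ext_iff.1 e
  exact ⟨q.comp p, a, b, by rw [StarWord.subst_comp, StarWord.substLin_comp]⟩

theorem consBr_consBr_mem_rbSystem (B : FreeOp k (Fin 2)) (a b w : BW Z) :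
    (BW.consBr a (BW.consBr b w), rhs B a b * mon k w) ∈ rbSystem B Z :=
  ⟨.star w, a, b, by rw [StarWord.substLin_star]; rfl⟩

theorem consBr_left_mem_rbSystem {t : BW Z} {v : FreeOp k Z} (h : (t, v) ∈ rbSystem B Z)
    (w : BW Z) : (BW.consBr t w, op k Z v * mon k w) ∈ rbSystem B Z := by
  have := subst_mem_rbSystem h (.brStar (.star 1) w)
  simpa [StarWord.substLin_brStar, StarWord.substLin_star, mon_one, StarWord.subst] using this

theorem consBr_right_mem_rbSystem {t : BW Z} {v : FreeOp k Z} (h : (t, v) ∈ rbSystem B Z)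
    (w : BW Z) : (BW.consBr w t, mon k w.br * v) ∈ rbSystem B Z := by
  have := subst_mem_rbSystem h (.consBr w (.star 1))
  simpa [StarWord.substLin_consBr, StarWord.substLin_star, mon_one, StarWord.subst] using this

theorem not_one_mem_rbSystem {v : FreeOp k Z} : (BW.one, v) ∉ rbSystem B Z := by
  rintro ⟨q, a, b, e⟩
  have e := (Prod.ext_iff.1 e).1
  cases q <;> cases e

theorem consVar_mem_rbSystem {z : Z} {t : BW Z} {v : FreeOp k Z}
    (h : (BW.consVar z t, v) ∈ rbSystem B Z) :
    ∃ v', (t, v') ∈ rbSystem B Z ∧ v = mon k (BW.var z) * v' := by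
  obtain ⟨q, a, b, e⟩ := h
  obtain ⟨e, rfl⟩ := Prod.ext_iff.1 e
  cases q with
  | star w => cases e
  | consVar y q =>
    cases e
    exact ⟨_, ⟨q, a, b, rfl⟩, StarWord.substLin_consVar k z q _⟩
  | brStar q w => cases e
  | consBr w q => cases e

/-- A rule for `⌊u⌋ t` rewrites at the front, inside of `u`, or inside of `t`. -/
theorem consBr_mem_rbSystem {u t : BW Z} {v : FreeOp k Z}
    (h : (BW.consBr u t, v) ∈ rbSystem B Z) :
    (∃ b w, t = BW.consBr b w ∧ v = rhs B u b * mon k w) ∨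
    (∃ v', (u, v') ∈ rbSystem B Z ∧ v = op k Z v' * mon k t) ∨
    ∃ v', (t, v') ∈ rbSystem B Z ∧ v = mon k u.br * v' := by
  obtain ⟨q, a, b, e⟩ := h
  obtain ⟨e, rfl⟩ := Prod.ext_iff.1 e
  cases q with
  | star w =>
    cases e
    exact .inl ⟨b, w, rfl, StarWord.substLin_star k w _⟩
  | consVar y q => cases e
  | brStar q w =>
    cases e
    exact .inr (.inl ⟨_, ⟨q, a, b, rfl⟩, StarWord.substLin_brStar k q t _⟩)
  | consBr w q =>
    cases e
    exact .inr (.inr ⟨_, ⟨q, a, b, rfl⟩, StarWord.substLin_consBr k u q _⟩)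

theorem irred_rbSystem_iff {w : BW Z} : Irred (rbSystem B Z) w ↔ w.IsRBNF := by
  refine not_congr ⟨?_, ?_⟩
  · rintro ⟨v, q, a, b, e⟩
    exact ⟨q, a, b, (Prod.ext_iff.1 e).1⟩
  · rintro ⟨q, a, b, rfl⟩
    exact ⟨_, q, a, b, rfl⟩

theorem decreasing_rbSystem {lt : BW Z → BW Z → Prop} (hlt : IsMonomialOrder lt)
    (hB : IsCompatible B lt) : Decreasing lt (rbSystem B Z) := by
  rintro t v ⟨q, a, b, e⟩
  obtain ⟨rfl, rfl⟩ := Prod.ext_iff.1 e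
  have key : suppIn k (lt · (a.br * b.br)) ≤
      (suppIn k (lt · (q.subst (a.br * b.br)))).comap (q.substLin k) :=
    suppIn_le_comap fun w hw => by
      rw [StarWord.substLin_mon]
      exact mon_mem_suppIn (hlt.subst_lt q _ _ hw)
  have h : rhs B a b ∈ suppIn k (lt · (a.br * b.br)) := hB a b
  exact mem_suppIn.1 (Submodule.mem_comap.1 (key h))

/-- Rules are closed under placing them in a context. The predicates keep track of the bound on
left-hand sides, be it a bracket count or an upper bound in the order. -/
theorem substLin_mem_ruleSpan {p p' : BW Z → Prop} (q : StarWord Z)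
    (h : ∀ t, p t → p' (q.subst t)) {f : FreeOp k Z} (hf : f ∈ ruleSpan (rbSystem B Z) p) :
    q.substLin k f ∈ ruleSpan (rbSystem B Z) p' := by
  have : ruleSpan (rbSystem B Z) p ≤ (ruleSpan (rbSystem B Z) p').comap (q.substLin k) := by
    refine Submodule.span_le.2 ?_
    rintro _ ⟨t, v, hR, ht, rfl⟩
    rw [SetLike.mem_coe, Submodule.mem_comap, map_sub, StarWord.substLin_mon]
    exact rule_mem_ruleSpan (subst_mem_rbSystem hR q) (h t ht)
  exact this hf

end Rules

/-! ### Filtrations by the number of brackets -/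

section Filtration

variable {k : Type u} [CommRing k] {Z : Type v}

/-- The elements whose monomials contain at most `n` brackets. -/
def degF (k : Type u) [CommRing k] (Z : Type v) (n : ℕ) : Submodule k (FreeOp k Z) :=
  suppIn k fun w : BW Z => w.degP ≤ n

/-- The span of the differences `t - v` for the rules `t → v` with at most `n` brackets in `t`. -/
def degJ (B : FreeOp k (Fin 2)) (Z : Type v) (n : ℕ) : Submodule k (FreeOp k Z) :=
  ruleSpan (rbSystem B Z) fun w : BW Z => w.degP ≤ n

/-- A filtration that is compatible with the filtration `degF` and the operator. -/
structure IsFiltration (M : ℕ → Submodule k (FreeOp k Z)) : Prop where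
  mono {i j : ℕ} {f : FreeOp k Z} (hf : f ∈ M i) (h : i ≤ j := by omega) : f ∈ M j
  mul_left {i j n : ℕ} {f g : FreeOp k Z} (hf : f ∈ degF k Z i) (hg : g ∈ M j)
    (h : i + j ≤ n := by omega) : f * g ∈ M n
  mul_right {i j n : ℕ} {f g : FreeOp k Z} (hf : f ∈ M i) (hg : g ∈ degF k Z j)
    (h : i + j ≤ n := by omega) : f * g ∈ M n
  op_mem {i n : ℕ} {f : FreeOp k Z} (hf : f ∈ M i) (h : i + 1 ≤ n := by omega) : op k Z f ∈ M n

theorem mon_mem_degF (w : BW Z) : mon k w ∈ degF k Z w.degP :=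
  mon_mem_suppIn (p := fun a => a.degP ≤ w.degP) le_rfl

theorem one_mem_degF : (1 : FreeOp k Z) ∈ degF k Z 0 := mon_mem_degF 1

/-- A criterion for filtrations that involves only words. -/
theorem IsFiltration.of_words {M : ℕ → Submodule k (FreeOp k Z)} (hM : Monotone M)
    (hl : ∀ n (w : BW Z) (g : FreeOp k Z), g ∈ M n → mon k w * g ∈ M (w.degP + n))
    (hr : ∀ n (w : BW Z) (g : FreeOp k Z), g ∈ M n → g * mon k w ∈ M (n + w.degP))
    (ho : ∀ n (g : FreeOp k Z), g ∈ M n → op k Z g ∈ M (n + 1)) : IsFiltration M where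
  mono hf h := hM h hf
  mul_left {i j n f g} hf hg h := by
    have : degF k Z i ≤ (M n).comap ((LinearMap.mul k (FreeOp k Z)).flip g) :=
      suppIn_le_comap fun w hw => hM (by omega) (hl j w g hg)
    exact this hf
  mul_right {i j n f g} hf hg h := by
    have : degF k Z j ≤ (M n).comap (LinearMap.mulLeft k f) :=
      suppIn_le_comap fun w hw => hM (by omega) (hr i w f hf)
    exact this hg
  op_mem hf h := hM h (ho _ _ hf)

theorem isFiltration_degF : IsFiltration (degF k Z) := by
  refine .of_words (fun i j h => suppIn_mono fun w hw => hw.trans h) ?_ ?_ ?_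
  · intro n w g hg
    have : degF k Z n ≤ (degF k Z (w.degP + n)).comap (LinearMap.mulLeft k (mon k w)) :=
      suppIn_le_comap fun a ha => by
        rw [LinearMap.mulLeft_apply, mon_mul_mon]
        exact mon_mem_suppIn (by rw [BW.degP_mul]; omega)
    exact this hg
  · intro n w g hg
    have : degF k Z n ≤
        (degF k Z (n + w.degP)).comap ((LinearMap.mul k (FreeOp k Z)).flip (mon k w)) :=
      suppIn_le_comap fun a ha => by
        rw [LinearMap.flip_apply, LinearMap.mul_apply', mon_mul_mon]
        exact mon_mem_suppIn (by rw [BW.degP_mul]; omega)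
    exact this hg
  · intro n g hg
    have : degF k Z n ≤ (degF k Z (n + 1)).comap (op k Z) :=
      suppIn_le_comap fun a ha => by
        rw [op_mon]
        exact mon_mem_suppIn (by simpa [BW.br, BW.degP] using ha)
    exact this hg

theorem isFiltration_degJ (B : FreeOp k (Fin 2)) : IsFiltration (degJ B Z) := by
  refine .of_words (fun i j h => ruleSpan_mono fun w hw => hw.trans h) ?_ ?_ ?_
  · intro n w g hg
    rw [← StarWord.substLin_mulLeft_star]
    refine substLin_mem_ruleSpan _ (fun t ht => ?_) hg
    rw [StarWord.subst_mulLeft]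
    simp only [StarWord.subst, mul_one, BW.degP_mul]
    omega
  · intro n w g hg
    rw [← StarWord.substLin_star]
    refine substLin_mem_ruleSpan _ (fun t ht => ?_) hg
    simp only [StarWord.subst, BW.degP_mul]
    omega
  · intro n g hg
    have := substLin_mem_ruleSpan (p' := fun w => w.degP ≤ n + 1) (.brStar (.star 1) 1)
      (fun t ht => by simpa [StarWord.subst, BW.degP] using ht) hg
    simpa [degJ, StarWord.substLin_brStar, StarWord.substLin_star, mon_one] using this

end Filtration

/-! ### Expressions that are combinations of a few basic words -/

section Basic

open BW

/-- The words in `x` and `y` that occur in the 14 expressions. -/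
inductive IsBasic : BW (Fin 2) → Prop
  | x_br_y : IsBasic (var 0 * (var 1).br)
  | br_x_y : IsBasic ((var 0).br * var 1)
  | y_br_x : IsBasic (var 1 * (var 0).br)
  | br_y_x : IsBasic ((var 1).br * var 0)
  | br_xy : IsBasic (br (var 0 * var 1))
  | xy : IsBasic (var 0 * var 1)
  | yx : IsBasic (var 1 * var 0)
  | x_br_one_y : IsBasic (var 0 * br 1 * var 1)
  | xy_br_one : IsBasic (var 0 * var 1 * br 1)
  | br_one_xy : IsBasic (br 1 * var 0 * var 1)
  | y_br_one_x : IsBasic (var 1 * br 1 * var 0)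

theorem IsBasic.count_eq_one {m : BW (Fin 2)} (hm : IsBasic m) (x : Fin 2) : m.count x = 1 := by
  have h1 : (1 : BW (Fin 2)) = one := rfl
  cases hm <;> fin_cases x <;>
    simp [var, br, h1, consVar_mul, consBr_mul, one_mul', count]

theorem IsBasic.isRBNF {m : BW (Fin 2)} (hm : IsBasic m) : m.IsRBNF := by
  have h1 : (1 : BW (Fin 2)) = one := rfl
  rw [isRBNF_iff]
  cases hm <;> simp [var, br, h1, consVar_mul, consBr_mul, one_mul', RBNFRec, StartsBr]

variable {k : Type u} [CommRing k] {Z : Type v} {B : FreeOp k (Fin 2)}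

/-- Membership of `B(f, g)` in a submodule can be tested on the basic words. -/
theorem subst₂_mem_of_isBasic (hB : B ∈ suppIn k IsBasic) {f g : FreeOp k Z}
    {M : Submodule k (FreeOp k Z)}
    (h : ∀ m, IsBasic m → evalWord (op k Z) ![f, g] m ∈ M) : subst₂ B f g ∈ M := by
  have : suppIn k IsBasic ≤ M.comap (eval (op k Z) ![f, g]) :=
    suppIn_le_comap fun m hm => by
      rw [eval_mon]
      exact h m hm
  exact this hB

/-- The summand `1` is the single bracket that a basic word may add. With `M = degF` this bounds the
size of `B(f, g)`; with `M = degJ` it carries rule differences through `B`. -/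
theorem subst₂_mem_of_left (hB : B ∈ suppIn k IsBasic) {M : ℕ → Submodule k (FreeOp k Z)}
    (hM : IsFiltration M) {i j n : ℕ} {f g : FreeOp k Z} (hf : f ∈ M i) (hg : g ∈ degF k Z j)
    (h : i + j + 1 ≤ n := by omega) : subst₂ B f g ∈ M n := by
  have h1 : op k Z 1 ∈ degF k Z 1 := isFiltration_degF.op_mem one_mem_degF
  have hPf : op k Z f ∈ M (i + 1) := hM.op_mem hf
  have hPg : op k Z g ∈ degF k Z (j + 1) := isFiltration_degF.op_mem hg
  refine subst₂_mem_of_isBasic hB fun m hm => ?_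
  cases hm <;> simp only [evalWord_mul, evalWord_br, evalWord_var, evalWord_one,
    Matrix.cons_val_zero, Matrix.cons_val_one]
  · exact hM.mul_right hf hPg
  · exact hM.mul_right hPf hg
  · exact hM.mul_left hg hPf
  · exact hM.mul_left hPg hf
  · exact hM.op_mem (hM.mul_right hf hg le_rfl)
  · exact hM.mul_right hf hg
  · exact hM.mul_left hg hf
  · exact hM.mul_right (hM.mul_right hf h1 le_rfl) hg
  · exact hM.mul_right (hM.mul_right hf hg le_rfl) h1
  · exact hM.mul_right (hM.mul_left h1 hf le_rfl) hg
  · exact hM.mul_left (isFiltration_degF.mul_left hg h1 le_rfl) hf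

theorem subst₂_mem_of_right (hB : B ∈ suppIn k IsBasic) {M : ℕ → Submodule k (FreeOp k Z)}
    (hM : IsFiltration M) {i j n : ℕ} {f g : FreeOp k Z} (hf : f ∈ degF k Z i) (hg : g ∈ M j)
    (h : i + j + 1 ≤ n := by omega) : subst₂ B f g ∈ M n := by
  have h1 : op k Z 1 ∈ degF k Z 1 := isFiltration_degF.op_mem one_mem_degF
  have hPf : op k Z f ∈ degF k Z (i + 1) := isFiltration_degF.op_mem hf
  have hPg : op k Z g ∈ M (j + 1) := hM.op_mem hg
  refine subst₂_mem_of_isBasic hB fun m hm => ?_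
  cases hm <;> simp only [evalWord_mul, evalWord_br, evalWord_var, evalWord_one,
    Matrix.cons_val_zero, Matrix.cons_val_one]
  · exact hM.mul_left hf hPg
  · exact hM.mul_left hPf hg
  · exact hM.mul_right hg hPf
  · exact hM.mul_right hPg hf
  · exact hM.op_mem (hM.mul_left hf hg le_rfl)
  · exact hM.mul_left hf hg
  · exact hM.mul_right hg hf
  · exact hM.mul_left (isFiltration_degF.mul_left hf h1 le_rfl) hg
  · exact hM.mul_right (hM.mul_left hf hg le_rfl) h1
  · exact hM.mul_left (isFiltration_degF.mul_left h1 hf le_rfl) hg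
  · exact hM.mul_right (hM.mul_right hg h1 le_rfl) hf

/-- Reduces the bilinearity of `B(f, g)` to a check on the eleven basic words, evaluation being
linear in `B`. -/
theorem eq_of_isBasic (hB : B ∈ suppIn k IsBasic) {A : Type w} [AddCommGroup A] [Module k A]
    {T T' : FreeOp k (Fin 2) →ₗ[k] A} (h : ∀ m, IsBasic m → T (mon k m) = T' (mon k m)) :
    T B = T' B := by
  have : suppIn k IsBasic ≤ (LinearMap.ker (T - T')).comap LinearMap.id :=
    suppIn_le_comap fun m hm => by simp [h m hm]
  simpa [sub_eq_zero] using this hB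

/-- `B(f, g)` as a bilinear map. -/
def substBilin (hB : B ∈ suppIn k IsBasic) (Z : Type v) :
    FreeOp k Z →ₗ[k] FreeOp k Z →ₗ[k] FreeOp k Z :=
  LinearMap.mk₂ k (subst₂ B)
    (fun f f' g => eq_of_isBasic (T := eval (op k Z) ![f + f', g])
      (T' := eval (op k Z) ![f, g] + eval (op k Z) ![f', g]) hB fun m hm => by
        cases hm <;> simp [eval_mon, evalWord_mul, evalWord_br, evalWord_var, evalWord_one, add_mul,
          mul_add])
    (fun c f g => eq_of_isBasic (T := eval (op k Z) ![c • f, g])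
      (T' := c • eval (op k Z) ![f, g]) hB fun m hm => by
        cases hm <;> simp [eval_mon, evalWord_mul, evalWord_br, evalWord_var, evalWord_one])
    (fun f g g' => eq_of_isBasic (T := eval (op k Z) ![f, g + g'])
      (T' := eval (op k Z) ![f, g] + eval (op k Z) ![f, g']) hB fun m hm => by
        cases hm <;> simp [eval_mon, evalWord_mul, evalWord_br, evalWord_var, evalWord_one, add_mul,
          mul_add])
    (fun c f g => eq_of_isBasic (T := eval (op k Z) ![f, c • g])
      (T' := c • eval (op k Z) ![f, g]) hB fun m hm => by
        cases hm <;> simp [eval_mon, evalWord_mul, evalWord_br, evalWord_var, evalWord_one])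

theorem substBilin_apply (hB : B ∈ suppIn k IsBasic) (f g : FreeOp k Z) :
    substBilin hB Z f g = subst₂ B f g := rfl

end Basic

/-! ### Local confluence -/

section LocalConfluence

variable {k : Type u} [CommRing k] {Z : Type v} {B : FreeOp k (Fin 2)}

theorem rule_sub_mem_degJ {t : BW Z} {v : FreeOp k Z} (h : (t, v) ∈ rbSystem B Z) :
    mon k t - v ∈ degJ B Z t.degP :=
  rule_mem_ruleSpan h le_rfl

/-- The two ways to rewrite `⌊a⌋⌊b⌋⌊c⌋` agree modulo rules with few brackets. -/
def IsAssociative (B : FreeOp k (Fin 2)) (Z : Type v) : Prop :=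
  ∀ a b c : BW Z, subst₂ B (subst₂ B (mon k a) (mon k b)) (mon k c) -
    subst₂ B (mon k a) (subst₂ B (mon k b) (mon k c)) ∈
      degJ B Z (a.degP + b.degP + c.degP + 2)

variable [LinearOrder Z]

/-- With the outer brackets counted, the left side has at most as many brackets as the right side. A
tie is decided by the `P`-breadth, which is smaller by one. -/
theorem consBr_lt_consBr_consBr {t a b : BW Z} (h : t.degP ≤ a.degP + b.degP + 1) (w : BW Z) :
    DbLT (BW.consBr t w) (BW.consBr a (BW.consBr b w)) := by
  rcases h.lt_or_eq with h | h
  · exact .degree (by simp [BW.degP]; omega)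
  · exact .breadth (by simp [BW.degP]; omega) (by simp [BW.breadthP, BW.brackets])

theorem isCompatible_dbLT (hB : B ∈ suppIn k IsBasic) : IsCompatible B (DbLT (Z := Z)) := by
  intro a b
  have h₁ : subst₂ B (mon k a) (mon k b) ∈ degF k Z (a.degP + b.degP + 1) :=
    subst₂_mem_of_left hB isFiltration_degF (mon_mem_degF a) (mon_mem_degF b)
  have h₂ : degF k Z (a.degP + b.degP + 1) ≤
      (suppIn k (DbLT · (a.br * b.br))).comap (op k Z) :=
    suppIn_le_comap fun w hw => by
      rw [op_mon]
      exact mon_mem_suppIn (consBr_lt_consBr_consBr hw 1)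
  exact h₂ h₁

/-- The differences of rules that lie below `w`. -/
abbrev dbSpan (B : FreeOp k (Fin 2)) (w : BW Z) : Submodule k (FreeOp k Z) :=
  ruleSpan (rbSystem B Z) (DbLT · w)

theorem op_mul_mem_dbSpan {a b w : BW Z} {n : ℕ} {f : FreeOp k Z} (hf : f ∈ degJ B Z n)
    (h : n ≤ a.degP + b.degP + 1) :
    op k Z f * mon k w ∈ dbSpan B (BW.consBr a (BW.consBr b w)) := by
  have := substLin_mem_ruleSpan (p' := (DbLT · (BW.consBr a (BW.consBr b w))))
    (.brStar (.star 1) w)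
    (fun t ht => consBr_lt_consBr_consBr (t := t * 1) (by rw [mul_one]; omega) w) hf
  simpa [StarWord.substLin_brStar, StarWord.substLin_star, mon_one] using this

theorem rule_mem_suppIn (hlt : IsMonomialOrder (DbLT (Z := Z))) (hB : B ∈ suppIn k IsBasic)
    {t : BW Z} {v : FreeOp k Z} (h : (t, v) ∈ rbSystem B Z) : v ∈ suppIn k (DbLT · t) :=
  decreasing_rbSystem hlt (isCompatible_dbLT hB) t v h

/-- Both branches meet at `⌊B(v, b)⌋ w`: one by rewriting `a` inside `B(a, b)`, the other by the
front rules for `⌊m⌋⌊b⌋` with `m` a monomial of `v`. -/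
theorem fork_front_left (hlt : IsMonomialOrder (DbLT (Z := Z))) (hB : B ∈ suppIn k IsBasic)
    {a : BW Z} {v : FreeOp k Z} (h : (a, v) ∈ rbSystem B Z) (b w : BW Z) :
    rhs B a b * mon k w - op k Z v * mon k (BW.consBr b w) ∈
      dbSpan B (BW.consBr a (BW.consBr b w)) := by
  have h₁ : op k Z (subst₂ B (mon k a - v) (mon k b)) * mon k w ∈
      dbSpan B (BW.consBr a (BW.consBr b w)) :=
    op_mul_mem_dbSpan (subst₂_mem_of_left hB (isFiltration_degJ B) (rule_sub_mem_degJ h)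
      (mon_mem_degF b) le_rfl) le_rfl
  have h₂ : suppIn k (DbLT · a) ≤ (dbSpan B (BW.consBr a (BW.consBr b w))).comap
      ((LinearMap.mul k (FreeOp k Z)).flip (mon k (BW.consBr b w)) ∘ₗ op k Z -
        (LinearMap.mul k (FreeOp k Z)).flip (mon k w) ∘ₗ op k Z ∘ₗ
          (substBilin hB Z).flip (mon k b)) :=
    suppIn_le_comap fun m hm => by
      have := rule_mem_ruleSpan (p := (DbLT · (BW.consBr a (BW.consBr b w))))
        (consBr_consBr_mem_rbSystem B m b w) (hm.consBr_left _)
      simpa [op_mon, mon_mul_mon, BW.br_mul, substBilin_apply] using this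
  have h₃ := h₂ (rule_mem_suppIn hlt hB h)
  simp only [Submodule.mem_comap, LinearMap.sub_apply, LinearMap.comp_apply, LinearMap.flip_apply,
    LinearMap.mul_apply', substBilin_apply] at h₃
  have e : subst₂ B (mon k a - v) (mon k b) =
      subst₂ B (mon k a) (mon k b) - subst₂ B v (mon k b) := by
    simp only [← substBilin_apply hB, map_sub, LinearMap.sub_apply]
  rw [e, map_sub, sub_mul] at h₁
  simpa using sub_mem h₁ h₃

/-- The common reduct is `⌊B(a, v)⌋ w`. -/
theorem fork_front_middle (hlt : IsMonomialOrder (DbLT (Z := Z))) (hB : B ∈ suppIn k IsBasic)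
    {b : BW Z} {v : FreeOp k Z} (h : (b, v) ∈ rbSystem B Z) (a w : BW Z) :
    rhs B a b * mon k w - mon k a.br * (op k Z v * mon k w) ∈
      dbSpan B (BW.consBr a (BW.consBr b w)) := by
  have h₁ : op k Z (subst₂ B (mon k a) (mon k b - v)) * mon k w ∈
      dbSpan B (BW.consBr a (BW.consBr b w)) :=
    op_mul_mem_dbSpan (subst₂_mem_of_right hB (isFiltration_degJ B) (mon_mem_degF a)
      (rule_sub_mem_degJ h) le_rfl) le_rfl
  have h₂ : suppIn k (DbLT · b) ≤ (dbSpan B (BW.consBr a (BW.consBr b w))).comap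
      (LinearMap.mulLeft k (mon k a.br) ∘ₗ
          (LinearMap.mul k (FreeOp k Z)).flip (mon k w) ∘ₗ op k Z -
        (LinearMap.mul k (FreeOp k Z)).flip (mon k w) ∘ₗ op k Z ∘ₗ
          substBilin hB Z (mon k a)) :=
    suppIn_le_comap fun m hm => by
      have := rule_mem_ruleSpan (p := (DbLT · (BW.consBr a (BW.consBr b w))))
        (consBr_consBr_mem_rbSystem B a m w) ((hm.consBr_left _).consBr_right _)
      simpa [op_mon, mon_mul_mon, BW.br_mul, substBilin_apply] using this
  have h₃ := h₂ (rule_mem_suppIn hlt hB h)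
  simp only [Submodule.mem_comap, LinearMap.sub_apply, LinearMap.comp_apply, LinearMap.flip_apply,
    LinearMap.mul_apply', LinearMap.mulLeft_apply, substBilin_apply] at h₃
  have e : subst₂ B (mon k a) (mon k b - v) =
      subst₂ B (mon k a) (mon k b) - subst₂ B (mon k a) v := by
    simp only [← substBilin_apply hB, map_sub]
  rw [e, map_sub, sub_mul] at h₁
  simpa using sub_mem h₁ h₃

/-- The two places are disjoint, and the common reduct is `⌊B(a, b)⌋ v`. -/
theorem fork_front_right {w : BW Z} {v : FreeOp k Z} (hlt : IsMonomialOrder (DbLT (Z := Z)))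
    (hB : B ∈ suppIn k IsBasic) (h : (w, v) ∈ rbSystem B Z) (a b : BW Z) :
    rhs B a b * mon k w - mon k a.br * (mon k b.br * v) ∈
      dbSpan B (BW.consBr a (BW.consBr b w)) := by
  have h₁ : suppIn k (DbLT · (a.br * b.br)) ≤ (dbSpan B (BW.consBr a (BW.consBr b w))).comap
      ((LinearMap.mul k (FreeOp k Z)).flip (mon k w - v)) :=
    suppIn_le_comap fun m hm => by
      have hm' : DbLT (m * w) (BW.consBr a (BW.consBr b w)) := hm.mul_right w
      have := rule_mem_ruleSpan (p := (DbLT · (BW.consBr a (BW.consBr b w))))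
        (subst_mem_rbSystem h (.mulLeft m (.star 1)))
        (by simpa [StarWord.subst_mulLeft, StarWord.subst] using hm')
      simpa [StarWord.subst_mulLeft, StarWord.subst, StarWord.substLin_mulLeft_star,
        ← mon_mul_mon, mul_sub] using this
  have h₂ : suppIn k (DbLT · w) ≤ (dbSpan B (BW.consBr a (BW.consBr b w))).comap
      (LinearMap.mulLeft k (mon k (a.br * b.br) - rhs B a b)) :=
    suppIn_le_comap fun m hm => by
      have := rule_mem_ruleSpan (p := (DbLT · (BW.consBr a (BW.consBr b w))))
        (consBr_consBr_mem_rbSystem B a b m) ((hm.consBr_right _).consBr_right _)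
      simpa [mon_mul_mon, BW.br_mul, BW.consBr_mul, sub_mul, BW.br, BW.one_mul'] using this
  have h₃ := h₁ (isCompatible_dbLT hB a b)
  have h₄ := h₂ (rule_mem_suppIn hlt hB h)
  simp only [Submodule.mem_comap, LinearMap.flip_apply, LinearMap.mul_apply',
    LinearMap.mulLeft_apply, ← mon_mul_mon] at h₃ h₄
  have := sub_mem h₃ h₄
  simpa [mul_sub, sub_mul, mul_assoc] using this

/-- The common reduct is `⌊v⌋ v'`. -/
theorem fork_disjoint {a w : BW Z} {v v' : FreeOp k Z} (hlt : IsMonomialOrder (DbLT (Z := Z)))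
    (hB : B ∈ suppIn k IsBasic) (h : (a, v) ∈ rbSystem B Z) (h' : (w, v') ∈ rbSystem B Z) :
    op k Z v * mon k w - mon k a.br * v' ∈ dbSpan B (BW.consBr a w) := by
  have h₁ : suppIn k (DbLT · a) ≤ (dbSpan B (BW.consBr a w)).comap
      ((LinearMap.mul k (FreeOp k Z)).flip (mon k w - v') ∘ₗ op k Z) :=
    suppIn_le_comap fun m hm => by
      have := rule_mem_ruleSpan (p := (DbLT · (BW.consBr a w)))
        (consBr_right_mem_rbSystem h' m) (hm.consBr_left _)
      simpa [op_mon, mul_sub, mon_mul_mon, BW.br_mul] using this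
  have h₂ : suppIn k (DbLT · w) ≤ (dbSpan B (BW.consBr a w)).comap
      (LinearMap.mulLeft k (mon k a.br - op k Z v)) :=
    suppIn_le_comap fun m hm => by
      have := rule_mem_ruleSpan (p := (DbLT · (BW.consBr a w)))
        (consBr_left_mem_rbSystem h m) (hm.consBr_right _)
      simpa [sub_mul, mon_mul_mon, BW.br_mul] using this
  have h₃ := h₁ (rule_mem_suppIn hlt hB h)
  have h₄ := h₂ (rule_mem_suppIn hlt hB h')
  simp only [Submodule.mem_comap, LinearMap.flip_apply, LinearMap.mul_apply',
    LinearMap.comp_apply, LinearMap.mulLeft_apply] at h₃ h₄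
  simpa [mul_sub, sub_mul] using sub_mem h₃ h₄

/-- The only fork that needs more than bilinearity. One further front rule on each side leads to
`⌊B(B(a,b),c)⌋ w` and `⌊B(a,B(b,c))⌋ w`, which `hA` compares. -/
theorem fork_overlap (hB : B ∈ suppIn k IsBasic) (hA : IsAssociative B Z) (a b c w : BW Z) :
    rhs B a b * mon k (BW.consBr c w) - mon k a.br * (rhs B b c * mon k w) ∈
      dbSpan B (BW.consBr a (BW.consBr b (BW.consBr c w))) := by
  set M := dbSpan B (BW.consBr a (BW.consBr b (BW.consBr c w))) with hM
  -- The outer bracket raises the bound by one, to the count for `⌊a⌋⌊b⌋⌊c⌋`. In case of a tie, one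
  -- top-level bracket in place of three decides.
  have hT : ∀ {n} {f : FreeOp k Z}, f ∈ degJ B Z n → n ≤ a.degP + b.degP + c.degP + 2 →
      op k Z f * mon k w ∈ M := by
    intro n f hf hn
    have := substLin_mem_ruleSpan
      (p' := (DbLT · (BW.consBr a (BW.consBr b (BW.consBr c w))))) (.brStar (.star 1) w)
      (fun t ht => ?_) hf
    · simpa [StarWord.substLin_brStar, StarWord.substLin_star, mon_one] using this
    · simp only [StarWord.subst, mul_one]
      rcases (ht.trans hn).lt_or_eq with h | h
      · exact .degree (by simp [BW.degP]; omega)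
      · exact .breadth (by simp [BW.degP]; omega) (by simp [BW.breadthP, BW.brackets])
  have h₁ : degF k Z (a.degP + b.degP + 1) ≤ M.comap
      ((LinearMap.mul k (FreeOp k Z)).flip (mon k (BW.consBr c w)) ∘ₗ op k Z -
        (LinearMap.mul k (FreeOp k Z)).flip (mon k w) ∘ₗ op k Z ∘ₗ
          (substBilin hB Z).flip (mon k c)) :=
    suppIn_le_comap fun m hm => by
      have := rule_mem_ruleSpan
        (p := (DbLT · (BW.consBr a (BW.consBr b (BW.consBr c w)))))
        (consBr_consBr_mem_rbSystem B m c w) (consBr_lt_consBr_consBr hm _)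
      simpa [op_mon, mon_mul_mon, BW.br_mul, substBilin_apply] using this
  have h₂ : degF k Z (b.degP + c.degP + 1) ≤ M.comap
      (LinearMap.mulLeft k (mon k a.br) ∘ₗ
          (LinearMap.mul k (FreeOp k Z)).flip (mon k w) ∘ₗ op k Z -
        (LinearMap.mul k (FreeOp k Z)).flip (mon k w) ∘ₗ op k Z ∘ₗ
          substBilin hB Z (mon k a)) :=
    suppIn_le_comap fun m hm => by
      have := rule_mem_ruleSpan
        (p := (DbLT · (BW.consBr a (BW.consBr b (BW.consBr c w)))))
        (consBr_consBr_mem_rbSystem B a m w) ((consBr_lt_consBr_consBr hm _).consBr_right _)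
      simpa [op_mon, mon_mul_mon, BW.br_mul, substBilin_apply] using this
  have h₃ := h₁ (subst₂_mem_of_left hB isFiltration_degF (mon_mem_degF a) (mon_mem_degF b))
  have h₄ := h₂ (subst₂_mem_of_left hB isFiltration_degF (mon_mem_degF b) (mon_mem_degF c))
  simp only [Submodule.mem_comap, LinearMap.sub_apply, LinearMap.comp_apply, LinearMap.flip_apply,
    LinearMap.mul_apply', LinearMap.mulLeft_apply, substBilin_apply] at h₃ h₄
  have h₅ := hT (hA a b c) le_rfl
  rw [map_sub, sub_mul] at h₅
  have := add_mem (sub_mem h₃ h₄) h₅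
  convert this using 1
  abel

/-- All forks at a monomial are trivial. -/
theorem fork_mem_dbSpan (hlt : IsMonomialOrder (DbLT (Z := Z))) (hB : B ∈ suppIn k IsBasic)
    (hA : IsAssociative B Z) (t : BW Z) (v v' : FreeOp k Z) (hv : (t, v) ∈ rbSystem B Z)
    (hv' : (t, v') ∈ rbSystem B Z) : v - v' ∈ dbSpan B t := by
  induction t generalizing v v' with
  | one => exact absurd hv not_one_mem_rbSystem
  | consVar z t ih =>
    obtain ⟨v, h, rfl⟩ := consVar_mem_rbSystem hv
    obtain ⟨v', h', rfl⟩ := consVar_mem_rbSystem hv'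
    have := substLin_mem_ruleSpan (p' := (DbLT · (BW.consVar z t))) (.consVar z (.star 1))
      (fun s hs => by simpa [StarWord.subst] using hs.consVar z) (ih v v' h h')
    simpa [StarWord.substLin_consVar, StarWord.substLin_star, mon_one, mul_sub] using this
  | consBr a t iha iht =>
    -- Forks between the rule at the front and a rule inside the tail. Among the nine combinations
    -- below, those in reversed order follow by a change of sign.
    have front : ∀ b w, t = BW.consBr b w → ∀ v', (t, v') ∈ rbSystem B Z →
        rhs B a b * mon k w - mon k a.br * v' ∈ dbSpan B (BW.consBr a t) := by
      rintro b w rfl v' h'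
      rcases consBr_mem_rbSystem h' with ⟨c, w, rfl, rfl⟩ | ⟨v, h, rfl⟩ | ⟨v, h, rfl⟩
      · exact fork_overlap hB hA a b c w
      · exact fork_front_middle hlt hB h a w
      · exact fork_front_right hlt hB h a b
    rcases consBr_mem_rbSystem hv with ⟨b, w, e, rfl⟩ | ⟨v, h, rfl⟩ | ⟨v, h, rfl⟩ <;>
      rcases consBr_mem_rbSystem hv' with ⟨b', w', e', rfl⟩ | ⟨v', h', rfl⟩ | ⟨v', h', rfl⟩
    · obtain ⟨rfl, rfl⟩ : b = b' ∧ w = w' := by simpa using e.symm.trans e'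
      simp
    · subst e
      exact fork_front_left hlt hB h' b w
    · exact front b w e v' h'
    · subst e'
      rw [← neg_mem_iff, neg_sub]
      exact fork_front_left hlt hB h b' w'
    · have := substLin_mem_ruleSpan (p' := (DbLT · (BW.consBr a t))) (.brStar (.star 1) t)
        (fun s hs => by simpa [StarWord.subst] using hs.consBr_left t) (iha v v' h h')
      simpa [StarWord.substLin_brStar, StarWord.substLin_star, mon_one, sub_mul] using this
    · exact fork_disjoint hlt hB h h'
    · rw [← neg_mem_iff, neg_sub]
      exact front b' w' e' v h
    · rw [← neg_mem_iff, neg_sub]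
      exact fork_disjoint hlt hB h' h
    · have := substLin_mem_ruleSpan (p' := (DbLT · (BW.consBr a t))) (.consBr a (.star 1))
        (fun s hs => by simpa [StarWord.subst] using hs.consBr_right a) (iht v v' h h')
      simpa [StarWord.substLin_consBr, StarWord.substLin_star, mon_one, mul_sub] using this

end LocalConfluence

/-! ### The 14 expressions -/

section Items

variable {k : Type u} [CommRing k] {Z : Type v}

theorem Item.expr_mem_suppIn (c lam : k) (t : Item) : t.expr c lam ∈ suppIn k IsBasic := by
  have h {m : BW (Fin 2)} (hm : IsBasic m) : mon k m ∈ suppIn k IsBasic := mon_mem_suppIn hm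
  cases t <;> simp only [Item.expr, ← mon_one, op_mon, mon_mul_mon] <;> with_reducible
    repeat' first
      | refine add_mem ?_ ?_
      | refine sub_mem ?_ ?_
      | refine Submodule.smul_mem _ _ ?_
      | refine h ?_
      | constructor

/-- On words, `φ(a, b)` is the difference of the rule for `⌊a⌋⌊b⌋`, which has two brackets more than
`a` and `b` together. Bilinearity does the rest. -/
theorem subst₂_phi_mem_degJ {B : FreeOp k (Fin 2)} (hB : B ∈ suppIn k IsBasic) {i j n : ℕ}
    {f g : FreeOp k Z} (hf : f ∈ degF k Z i) (hg : g ∈ degF k Z j)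
    (h : i + j + 2 ≤ n := by omega) : subst₂ (phi B) f g ∈ degJ B Z n := by
  have key (a : BW Z) (ha : a.degP ≤ i) : degF k Z j ≤ (degJ B Z n).comap
      (LinearMap.mulLeft k (op k Z (mon k a)) ∘ₗ op k Z -
        op k Z ∘ₗ substBilin hB Z (mon k a)) :=
    suppIn_le_comap fun b hb => by
      have := rule_mem_ruleSpan (p := fun w : BW Z => w.degP ≤ n)
        (consBr_consBr_mem_rbSystem B a b 1) (by simp [BW.degP] at hb ⊢; omega)
      rw [show BW.consBr a (BW.consBr b 1) = a.br * b.br from rfl, mon_one, mul_one] at this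
      simpa [degJ, op_mon, mon_mul_mon, substBilin_apply] using this
  have key' : degF k Z i ≤ (degJ B Z n).comap
      ((LinearMap.mul k (FreeOp k Z)).flip (op k Z g) ∘ₗ op k Z -
        op k Z ∘ₗ (substBilin hB Z).flip g) :=
    suppIn_le_comap fun a ha => by
      simpa [substBilin_apply] using key a ha hg
  rw [subst₂_phi]
  simpa [substBilin_apply] using key' hf

theorem subst₂_expr (c lam : k) (t : Item) (x y : FreeOp k Z) :
    subst₂ (t.expr c lam) x y =
      match t with
      | .a => x * op k Z y
      | .b => op k Z x * y
      | .c => x * op k Z y + y * op k Z x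
      | .d => op k Z x * y + op k Z y * x
      | .e => x * op k Z y + op k Z x * y - op k Z (x * y)
      | .f => x * op k Z y + op k Z x * y + lam • (x * y)
      | .g => x * op k Z y - x * op k Z 1 * y + lam • (x * y)
      | .h => op k Z x * y - x * op k Z 1 * y + lam • (x * y)
      | .i => x * op k Z y + op k Z x * y - x * op k Z 1 * y + lam • (x * y)
      | .j => x * op k Z y + op k Z x * y - x * y * op k Z 1 - x * op k Z 1 * y + lam • (x * y)
      | .k => x * op k Z y + op k Z x * y - x * op k Z 1 * y - op k Z (x * y) + lam • (x * y)
      | .l => x * op k Z y + op k Z x * y - x * op k Z 1 * y - op k Z 1 * x * y + lam • (x * y)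
      | .m => c • (x * op k Z 1 * y) + lam • (x * y)
      | .n => c • (y * op k Z 1 * x) + lam • (y * x) := by
  cases t <;>
    simp [subst₂, Item.expr, eval_mul, eval_op, eval_mon, evalWord_var, eval_one]

/-- The defect of associativity of `B`, expressed by values of `φ`. -/
theorem subst₂_expr_assoc (c lam : k) (t : Item) (u v w : FreeOp k Z) :
    letI B := subst₂ (Z := Z) (t.expr c lam)
    letI φ := subst₂ (Z := Z) (phi (t.expr c lam))
    B (B u v) w - B u (B v w) =
      match t with
      | .a => u * φ v w
      | .b => -(φ u v * w)
      | .c => u * φ v w + v * φ u w - v * φ w u - w * φ v u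
      | .d => φ w u * v + φ w v * u - φ u v * w - φ u w * v
      | .e => u * φ v w - φ (u * v) w - φ u v * w + φ u (v * w)
      | .f => u * φ v w - φ u v * w
      | .g => u * φ v w - u * φ v 1 * w
      | .h => u * φ 1 v * w - φ u v * w
      | .i => u * φ v w - u * φ v 1 * w - φ u v * w + u * φ 1 v * w
      | .j => u * φ v w - u * v * φ 1 w - u * φ v 1 * w + u * v * φ 1 1 * w - φ u v * w +
          u * v * φ w 1 - u * v * w * φ 1 1 + u * φ 1 v * w
      | .k => u * φ v w - φ (u * v) w - u * φ v 1 * w + φ (u * v) 1 * w - φ u v * w +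
          φ u (v * w) + u * φ 1 v * w - u * φ 1 (v * w)
      | .l => u * φ v w - u * φ v 1 * w - φ 1 u * v * w + φ 1 1 * u * v * w - φ u v * w +
          φ u 1 * v * w + u * φ 1 v * w - u * φ 1 1 * v * w
      | .m => 0
      | .n => 0 := by
  -- After expansion these are identities between noncommutative polynomials, linear in the
  -- constants. For the last two items `B(x, y)` is `x e y` or `y e x` with `e = c⌊1⌋ + λ`, which is
  -- associative on the nose.
  cases t <;> simp only [subst₂_phi, subst₂_expr] <;>
    simp only [mul_add, add_mul, mul_sub, sub_mul, map_add, map_sub, map_smul, smul_mul_assoc,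
      mul_smul_comm, mul_assoc, mul_one, one_mul] <;>
    module

/-- In each term of the defect the three arguments occur once, the other factors are `1`, and one
value of `φ` contributes two brackets. So the bound is met term by term. -/
theorem isAssociative_expr (c lam : k) (t : Item) : IsAssociative (t.expr c lam) Z := by
  intro a b d
  have hB := t.expr_mem_suppIn c lam
  have hF := isFiltration_degF (k := k) (Z := Z)
  have ha := mon_mem_degF (k := k) a
  have hb := mon_mem_degF (k := k) b
  have hd := mon_mem_degF (k := k) d
  have h1 := one_mem_degF (k := k) (Z := Z)
  have hab := hF.mul_left ha hb le_rfl
  have hbd := hF.mul_left hb hd le_rfl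
  have habd := hF.mul_left hab hd le_rfl
  rw [subst₂_expr_assoc]
  have hφ {i j : ℕ} {f g : FreeOp k Z} (hf : f ∈ degF k Z i) (hg : g ∈ degF k Z j) :
      subst₂ (phi (t.expr c lam)) f g ∈ degJ (t.expr c lam) Z (i + j + 2) :=
    subst₂_phi_mem_degJ hB hf hg
  have hl {i j : ℕ} {f g : FreeOp k Z} (hf : f ∈ degF k Z i) (hg : g ∈ degJ (t.expr c lam) Z j) :=
    (isFiltration_degJ (t.expr c lam)).mul_left hf hg le_rfl
  have hr {i j : ℕ} {f g : FreeOp k Z} (hf : f ∈ degJ (t.expr c lam) Z i) (hg : g ∈ degF k Z j) :=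
    (isFiltration_degJ (t.expr c lam)).mul_right hf hg le_rfl
  have hm {i : ℕ} {f : FreeOp k Z} (hf : f ∈ degJ (t.expr c lam) Z i)
      (h : i ≤ a.degP + b.degP + d.degP + 2 := by omega) :
      f ∈ degJ (t.expr c lam) Z (a.degP + b.degP + d.degP + 2) :=
    (isFiltration_degJ (t.expr c lam)).mono hf h
  have e₁ := hm (hl ha (hφ hb hd))
  have e₂ := hm (hr (hφ ha hb) hd)
  have e₃ := hm (hr (hl ha (hφ hb h1)) hd)
  have e₄ := hm (hr (hl ha (hφ h1 hb)) hd)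
  have e₅ := hm (hφ hab hd)
  have e₆ := hm (hφ ha hbd)
  cases t with
  | a => exact e₁
  | b => exact neg_mem e₂
  | c =>
    exact sub_mem (sub_mem (add_mem e₁ (hm (hl hb (hφ ha hd)))) (hm (hl hb (hφ hd ha))))
      (hm (hl hd (hφ hb ha)))
  | d =>
    exact sub_mem (sub_mem (add_mem (hm (hr (hφ hd ha) hb)) (hm (hr (hφ hd hb) ha))) e₂)
      (hm (hr (hφ ha hd) hb))
  | e => exact add_mem (sub_mem (sub_mem e₁ e₅) e₂) e₆
  | f => exact sub_mem e₁ e₂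
  | g => exact sub_mem e₁ e₃
  | h => exact sub_mem e₄ e₂
  | i => exact add_mem (sub_mem (sub_mem e₁ e₃) e₂) e₄
  | j =>
    exact add_mem (sub_mem (add_mem (sub_mem (add_mem (sub_mem (sub_mem e₁ (hm (hl hab (hφ h1 hd))))
      e₃) (hm (hr (hl hab (hφ h1 h1)) hd))) e₂) (hm (hl hab (hφ hd h1))))
      (hm (hl habd (hφ h1 h1)))) e₄
  | k =>
    exact sub_mem (add_mem (add_mem (sub_mem (add_mem (sub_mem (sub_mem e₁ e₅) e₃)
      (hm (hr (hφ hab h1) hd))) e₂) e₆) e₄) (hm (hl ha (hφ h1 hbd)))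
  | l =>
    exact sub_mem (add_mem (add_mem (sub_mem (add_mem (sub_mem (sub_mem e₁ e₃)
      (hm (hr (hr (hφ h1 ha) hb) hd))) (hm (hr (hr (hr (hφ h1 h1) ha) hb) hd))) e₂)
      (hm (hr (hr (hφ ha h1) hb) hd))) e₄) (hm (hr (hr (hl ha (hφ h1 h1)) hb) hd))
  | m => exact zero_mem _
  | n => exact zero_mem _

end Items

/-! ### Convergence and Gröbner-Shirshov bases -/

section Convergence

variable {k : Type u} [CommRing k] {Z : Type v} {B : FreeOp k (Fin 2)}

theorem wellFounded_oneStep_rbSystem [LinearOrder Z] [WellFoundedLT Z]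
    (hB : B ∈ suppIn k IsBasic) : WellFounded fun g f => OneStep (rbSystem B Z) f g :=
  wellFounded_oneStep DbLT.isMonomialOrder.wellOrder
    (decreasing_rbSystem DbLT.isMonomialOrder (isCompatible_dbLT hB))

theorem exists_isNormalFormMap [LinearOrder Z] [WellFoundedLT Z] (hB : B ∈ suppIn k IsBasic)
    (hA : IsAssociative B Z) : ∃ N, IsNormalFormMap (rbSystem B Z) N :=
  exists_normalForm DbLT.isMonomialOrder.wellOrder
    (decreasing_rbSystem DbLT.isMonomialOrder (isCompatible_dbLT hB))
    (fork_mem_dbSpan DbLT.isMonomialOrder hB hA)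

theorem terminating_rbSystem (hB : B ∈ suppIn k IsBasic) (Z : Type v) :
    Terminating (rbSystem B Z) := by
  -- The rewriting system involves no order on `Z`, so any well-order may be chosen.
  obtain ⟨_, _⟩ := exists_wellFoundedLT Z
  exact terminating_of_wellFounded (wellFounded_oneStep_rbSystem hB)

theorem reduces_zero_of_mem (hB : B ∈ suppIn k IsBasic) (hA : IsAssociative B Z)
    {f : FreeOp k Z} (hf : f ∈ ruleSpan (rbSystem B Z) fun _ => True) :
    Reduces (rbSystem B Z) f 0 := by
  obtain ⟨_, _⟩ := exists_wellFoundedLT Z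
  obtain ⟨N, hN⟩ := exists_isNormalFormMap hB hA
  exact hN.reduces_zero (wellFounded_oneStep_rbSystem hB) hf

theorem convergent_rbSystem [LinearOrder Z] [WellFoundedLT Z] (hB : B ∈ suppIn k IsBasic)
    (hA : IsAssociative B Z) : Convergent (rbSystem B Z) := by
  obtain ⟨N, hN⟩ := exists_isNormalFormMap hB hA
  exact ⟨terminating_rbSystem hB Z, hN.confluent (wellFounded_oneStep_rbSystem hB)⟩

theorem isRotaBaxterType_phi (hB : B ∈ suppIn k IsBasic)
    (hA : ∀ Z : Type v, IsAssociative B Z) : IsRotaBaxterType.{u, v} (phi B) :=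
  ⟨B, rfl, fun _ hm => (hB hm).count_eq_one, fun _ hm => (hB hm).isRBNF,
    terminating_rbSystem hB, fun Z a b c => reduces_zero_of_mem hB (hA Z)
      (ruleSpan_mono (fun _ _ => trivial) (hA Z a b c))⟩

theorem IsLeading.unique {lt : BW Z → BW Z → Prop} (wo : IsWellOrder (BW Z) lt)
    {f : FreeOp k Z} {w w' : BW Z} (h : IsLeading lt f w) (h' : IsLeading lt f w') : w = w' := by
  by_contra hne
  exact asymm_of lt (h.2 w' h'.1 (Ne.symm hne)) (h'.2 w h.1 hne)

/-- The leading monomial of `φ(u, v)` is `⌊u⌋⌊v⌋`, with coefficient `1`. -/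
theorem isLeading_subst₂_phi [Nontrivial k] {lt : BW Z → BW Z → Prop}
    (wo : IsWellOrder (BW Z) lt) (hc : IsCompatible B lt) (u v : BW Z) :
    IsLeading lt (subst₂ (phi B) (mon k u) (mon k v)) (u.br * v.br) ∧
      (subst₂ (phi B) (mon k u) (mon k v)).coeff (u.br * v.br) = 1 := by
  have e : subst₂ (phi B) (mon k u) (mon k v) = mon k (u.br * v.br) - rhs B u v := by
    rw [subst₂_phi, op_mon, op_mon, mon_mul_mon]
  have h0 : (rhs B u v).coeff (u.br * v.br) = 0 :=
    coeff_eq_zero_of_mem_suppIn (p := (lt · (u.br * v.br))) (hc u v) (irrefl_of lt _)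
  have h1 : (subst₂ (phi B) (mon k u) (mon k v)).coeff (u.br * v.br) = 1 := by
    simp [e, h0, coeff_mon_self]
  refine ⟨⟨Finsupp.mem_support_iff.2 (by rw [h1]; exact one_ne_zero), fun m hm hne => ?_⟩, h1⟩
  have : subst₂ (phi B) (mon k u) (mon k v) ∈
      suppIn k fun m => m = u.br * v.br ∨ lt m (u.br * v.br) := by
    rw [e]
    exact sub_mem (mon_mem_suppIn (.inl rfl))
      (suppIn_mono (fun _ => .inr) (show rhs B u v ∈ suppIn k (lt · (u.br * v.br)) from hc u v))
  exact (this hm).resolve_left hne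

/-- What is needed about the elements of `S_φ(Z)`. -/
theorem monGenerators_spec [Nontrivial k] {lt : BW Z → BW Z → Prop}
    (wo : IsWellOrder (BW Z) lt) (hc : IsCompatible B lt) {s : FreeOp k Z} {w : BW Z}
    (hs : s ∈ monGenerators (phi B) Z) (hw : IsLeading lt s w) :
    s - mon k w ∈ suppIn k (lt · w) ∧ s ∈ ruleSpan (rbSystem B Z) fun _ => True := by
  obtain ⟨u, v, rfl⟩ := hs
  obtain rfl := hw.unique wo (isLeading_subst₂_phi wo hc u v).1
  have h : rhs B u v ∈ suppIn k (lt · (u.br * v.br)) := hc u v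
  have e : subst₂ (phi B) (mon k u) (mon k v) = mon k (u.br * v.br) - rhs B u v := by
    rw [subst₂_phi, op_mon, op_mon, mon_mul_mon]
  rw [e]
  constructor
  · simpa using h
  · have := consBr_consBr_mem_rbSystem B u v 1
    rw [mon_one, mul_one] at this
    exact rule_mem_ruleSpan this trivial

theorem substLin_mem_suppIn {lt : BW Z → BW Z → Prop} (hlt : IsMonomialOrder lt) (q : StarWord Z)
    {w : BW Z} {f : FreeOp k Z} (hf : f ∈ suppIn k (lt · w)) :
    q.substLin k f ∈ suppIn k (lt · (q.subst w)) := by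
  have : suppIn k (lt · w) ≤ (suppIn k (lt · (q.subst w))).comap (q.substLin k) :=
    suppIn_le_comap fun m hm => by
      rw [StarWord.substLin_mon]
      exact mon_mem_suppIn (hlt.subst_lt q _ _ hm)
  exact this hf

/-- Reduction to `0` does not refer to an order and is available through `DbLT`. The order `lt`
enters only to see that this reduction stays below `w`. -/
theorem isTrivialMod_of_mem [Nontrivial k] {lt : BW Z → BW Z → Prop} (hlt : IsMonomialOrder lt)
    (hc : IsCompatible B lt) (hB : B ∈ suppIn k IsBasic) (hA : IsAssociative B Z) {w : BW Z}
    {f : FreeOp k Z} (hf : f ∈ ruleSpan (rbSystem B Z) fun _ => True)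
    (hw : f ∈ suppIn k (lt · w)) : IsTrivialMod lt (monGenerators (phi B) Z) w f := by
  have h := (reduces_zero_of_mem hB hA hf).mem_ruleSpan_lt hlt.wellOrder
    (decreasing_rbSystem hlt hc) hw
  refine Submodule.span_le.2 ?_ h
  rintro _ ⟨t, v, ⟨q, a, b, e⟩, ht, rfl⟩
  obtain ⟨rfl, rfl⟩ := Prod.ext_iff.1 e
  refine Submodule.subset_span ⟨q, _, _, ⟨a, b, rfl⟩,
    (isLeading_subst₂_phi hlt.wellOrder hc a b).1, ht, ?_⟩
  rw [subst₂_phi, map_sub, op_mon, op_mon, mon_mul_mon, StarWord.substLin_mon]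

/-- No overlaps need to be classified: in a composition the leading monomials cancel, so it lies
below `w`, and it belongs to the span of the differences of rules. -/
theorem isGSBasis_monGenerators [Nontrivial k] {lt : BW Z → BW Z → Prop}
    (hlt : IsMonomialOrder lt) (hc : IsCompatible B lt) (hB : B ∈ suppIn k IsBasic)
    (hA : IsAssociative B Z) : IsGSBasis lt (monGenerators (phi B) Z) where
  monic := by
    rintro _ ⟨u, v, rfl⟩
    exact ⟨_, isLeading_subst₂_phi hlt.wellOrder hc u v⟩
  intersection f hf g hg f' g' μ ν hf' hg' e _ _ := by
    obtain ⟨h₁, h₂⟩ := monGenerators_spec hlt.wellOrder hc hf hf'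
    obtain ⟨h₃, h₄⟩ := monGenerators_spec hlt.wellOrder hc hg hg'
    refine isTrivialMod_of_mem hlt hc hB hA ?_ ?_
    · rw [← StarWord.substLin_star, ← StarWord.substLin_mulLeft_star]
      exact sub_mem (substLin_mem_ruleSpan _ (fun _ _ => trivial) h₂)
        (substLin_mem_ruleSpan _ (fun _ _ => trivial) h₄)
    · have h₅ := substLin_mem_suppIn hlt (.star μ) h₁
      have h₆ := substLin_mem_suppIn hlt (.mulLeft ν (.star 1)) h₃
      rw [StarWord.substLin_star] at h₅
      rw [StarWord.substLin_mulLeft_star, StarWord.subst_mulLeft] at h₆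
      simp only [StarWord.subst, mul_one, ← e] at h₅ h₆
      have := sub_mem h₅ h₆
      rwa [sub_mul, mul_sub, mon_mul_mon, mon_mul_mon, ← e, sub_sub_sub_cancel_right] at this
  including f hf g hg f' g' q hf' hg' e := by
    obtain ⟨h₁, h₂⟩ := monGenerators_spec hlt.wellOrder hc hf hf'
    obtain ⟨h₃, h₄⟩ := monGenerators_spec hlt.wellOrder hc hg hg'
    refine isTrivialMod_of_mem hlt hc hB hA
      (sub_mem h₂ (substLin_mem_ruleSpan _ (fun _ _ => trivial) h₄)) ?_
    have h₅ := substLin_mem_suppIn hlt q h₃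
    rw [← e, map_sub, StarWord.substLin_mon, ← e] at h₅
    simpa using sub_mem h₁ h₅

end Convergence

/-! ### The operated ideal generated by `φ` -/

section Ideal

variable {k : Type u} [CommRing k] {Z : Type v} {B : FreeOp k (Fin 2)}

theorem isOperatedIdeal_phiIdeal (φ : FreeOp k (Fin 2)) (Z : Type v) :
    IsOperatedIdeal (phiIdeal φ Z) where
  mul_left f g hg := Submodule.mem_sInf.2 fun I hI =>
    hI.1.mul_left f g (Submodule.mem_sInf.1 hg I hI)
  mul_right f g hf := Submodule.mem_sInf.2 fun I hI =>
    hI.1.mul_right f g (Submodule.mem_sInf.1 hf I hI)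
  op_mem f hf := Submodule.mem_sInf.2 fun I hI =>
    hI.1.op_mem f (Submodule.mem_sInf.1 hf I hI)

theorem subst₂_mem_phiIdeal (φ : FreeOp k (Fin 2)) (f g : FreeOp k Z) :
    subst₂ φ f g ∈ phiIdeal φ Z :=
  Submodule.mem_sInf.2 fun _ hI => hI.2 f g

theorem IsOperatedIdeal.substLin_mem {I : Submodule k (FreeOp k Z)} (hI : IsOperatedIdeal I)
    {f : FreeOp k Z} (hf : f ∈ I) (q : StarWord Z) : q.substLin k f ∈ I := by
  induction q with
  | star w => rw [StarWord.substLin_star]; exact hI.mul_right _ _ hf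
  | consVar z q ih => rw [StarWord.substLin_consVar]; exact hI.mul_left _ _ ih
  | brStar q w ih => rw [StarWord.substLin_brStar]; exact hI.mul_right _ _ (hI.op_mem _ ih)
  | consBr u q ih => rw [StarWord.substLin_consBr]; exact hI.mul_left _ _ ih

theorem isOperatedIdeal_ruleSpan (B : FreeOp k (Fin 2)) (Z : Type v) :
    IsOperatedIdeal (ruleSpan (rbSystem B Z) fun _ => True) where
  mul_left f g hg := by
    have : suppIn k (fun _ => True) ≤ (ruleSpan (rbSystem B Z) fun _ => True).comap
        ((LinearMap.mul k (FreeOp k Z)).flip g) :=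
      suppIn_le_comap fun w _ => by
        rw [LinearMap.flip_apply, LinearMap.mul_apply', ← StarWord.substLin_mulLeft_star]
        exact substLin_mem_ruleSpan _ (fun _ _ => trivial) hg
    exact this (mem_suppIn.2 fun _ _ => trivial)
  mul_right f g hf := by
    have : suppIn k (fun _ => True) ≤ (ruleSpan (rbSystem B Z) fun _ => True).comap
        (LinearMap.mulLeft k f) :=
      suppIn_le_comap fun w _ => by
        rw [LinearMap.mulLeft_apply, ← StarWord.substLin_star]
        exact substLin_mem_ruleSpan _ (fun _ _ => trivial) hf
    exact this (mem_suppIn.2 fun _ _ => trivial)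
  op_mem f hf := by
    have := substLin_mem_ruleSpan (p' := fun _ => True) (.brStar (.star 1) 1)
      (fun _ _ => trivial) hf
    simpa [StarWord.substLin_brStar, StarWord.substLin_star, mon_one] using this

theorem exists_mem_degF (f : FreeOp k Z) : ∃ n, f ∈ degF k Z n :=
  ⟨(supp f).sup BW.degP, mem_suppIn.2 fun _ hm => Finset.le_sup (f := BW.degP) hm⟩

/-- The span is itself an operated ideal and contains all `φ(f, g)` by bilinearity. Conversely, each
difference of a rule is `q|_{φ(a, b)}`. -/
theorem phiIdeal_eq_ruleSpan (hB : B ∈ suppIn k IsBasic) (Z : Type v) :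
    phiIdeal (phi B) Z = ruleSpan (rbSystem B Z) fun _ => True := by
  refine le_antisymm (sInf_le ⟨isOperatedIdeal_ruleSpan B Z, fun f g => ?_⟩) ?_
  · obtain ⟨i, hi⟩ := exists_mem_degF f
    obtain ⟨j, hj⟩ := exists_mem_degF g
    exact ruleSpan_mono (fun _ _ => trivial) (subst₂_phi_mem_degJ hB hi hj le_rfl)
  · refine Submodule.span_le.2 ?_
    rintro _ ⟨t, v, ⟨q, a, b, e⟩, -, rfl⟩
    obtain ⟨rfl, rfl⟩ := Prod.ext_iff.1 e
    have := (isOperatedIdeal_phiIdeal (phi B) Z).substLin_mem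
      (subst₂_mem_phiIdeal (phi B) (mon k a) (mon k b)) q
    rwa [subst₂_phi, map_sub, op_mon, op_mon, mon_mul_mon, StarWord.substLin_mon] at this

end Ideal

/-! ### The free `φ`-algebra -/

section Free

variable {k : Type u} [CommRing k] {Z : Type v} {B : FreeOp k (Fin 2)}

theorem incl_single (w : RBW Z) : incl k Z (Finsupp.single w 1) = mon k w.1 := by
  simp [incl]

theorem incl_injective : Function.Injective (incl k Z) := by
  classical
  let r : FreeOp k Z →ₗ[k] RBSpan k Z :=
    linExt fun w => if h : w.IsRBNF then Finsupp.single (⟨w, h⟩ : RBW Z) (1 : k) else 0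
  have h : r ∘ₗ incl k Z = LinearMap.id := by
    refine Finsupp.lhom_ext' fun w => LinearMap.ext_ring ?_
    have hw : w.1.IsRBNF := w.2
    simp only [LinearMap.comp_apply, Finsupp.lsingle_apply, incl_single, LinearMap.id_apply]
    rw [show r (mon k w.1) = _ from linExt_mon _ _, dif_pos hw]
    rfl
  exact Function.LeftInverse.injective (g := r) fun a => congr($h a)

theorem suppIn_isRBNF_le_range : suppIn k BW.IsRBNF ≤ LinearMap.range (incl k Z) := by
  have : suppIn k BW.IsRBNF ≤ (LinearMap.range (incl k Z)).comap LinearMap.id :=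
    suppIn_le_comap fun w hw => ⟨Finsupp.single ⟨w, hw⟩ 1, incl_single ⟨w, hw⟩⟩
  exact this

/-- `kℜ(Z)` is a complement of the ideal `I_φ(Z)`. -/
theorem bijective_mkQ_incl [LinearOrder Z] [WellFoundedLT Z] (hB : B ∈ suppIn k IsBasic)
    (hA : IsAssociative B Z) :
    Function.Bijective ((phiIdeal (phi B) Z).mkQ ∘ₗ incl k Z) := by
  obtain ⟨N, hN⟩ := exists_isNormalFormMap hB hA
  have hirr {w : BW Z} (hw : w.IsRBNF) : Irred (rbSystem B Z) w := irred_rbSystem_iff.2 hw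
  have hincl (a : RBSpan k Z) : N (incl k Z a) = incl k Z a := by
    have : N ∘ₗ incl k Z = incl k Z := by
      refine Finsupp.lhom_ext' fun w => LinearMap.ext_ring ?_
      simp only [LinearMap.comp_apply, Finsupp.lsingle_apply, incl_single]
      exact hN.map_irred _ (mon_mem_suppIn (hirr w.2))
    exact congr($this a)
  constructor
  -- An element of `kℜ(Z)` inside the ideal is both fixed and killed by `N`.
  · rw [← LinearMap.ker_eq_bot, LinearMap.ker_eq_bot']
    intro a ha
    rw [LinearMap.comp_apply, Submodule.mkQ_apply, Submodule.Quotient.mk_eq_zero,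
      phiIdeal_eq_ruleSpan hB] at ha
    refine incl_injective ?_
    rw [← hincl, hN.map_eq_zero _ ha, map_zero]
  · intro x
    obtain ⟨f, rfl⟩ := Submodule.mkQ_surjective _ x
    obtain ⟨h₁, h₂⟩ := hN.reduces (wellFounded_oneStep_rbSystem hB) f
    obtain ⟨a, ha⟩ := suppIn_isRBNF_le_range
      (suppIn_mono (fun w hw => irred_rbSystem_iff.1 hw) h₂)
    refine ⟨a, ?_⟩
    rw [LinearMap.comp_apply, ha, Submodule.mkQ_apply, Submodule.mkQ_apply, eq_comm,
      Submodule.Quotient.eq, phiIdeal_eq_ruleSpan hB]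
    exact h₁.sub_mem_ruleSpan

/-- A surjective image of the free operated algebra by `I_φ(Z)` is the free `φ`-algebra. -/
theorem isFreePhiAlgebra_of_surjective {φ : FreeOp k (Fin 2)} {A : Type*} [Ring A] [Algebra k A]
    (P : A →ₗ[k] A) (i : Z → A) (N : FreeOp k Z →ₐ[k] A) (hs : Function.Surjective N)
    (hP : ∀ f, N (op k Z f) = P (N f)) (hi : ∀ z, N (mon k (BW.var z)) = i z)
    (hker : ∀ f, N f = 0 ↔ f ∈ phiIdeal φ Z) : IsFreePhiAlgebra.{u, w} φ P i where
  isPhiAlgebra r := by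
    obtain ⟨f, hf⟩ := hs (r 0)
    obtain ⟨g, hg⟩ := hs (r 1)
    -- By surjectivity every evaluation of `φ` in `A` is the image of some `φ(f, g)`, which lies in
    -- the ideal.
    have hr : r = fun x => N (![f, g] x) := by
      ext x
      fin_cases x
      · exact hf.symm
      · exact hg.symm
    rw [hr, ← map_eval (P := op k Z) ![f, g] N hP]
    exact (hker _).2 (subst₂_mem_phiIdeal φ f g)
  existsUnique R _ _ Q hQ f := by
    have hop (a : FreeOp k Z) : evalHom Q f (op k Z a) = Q (evalHom Q f a) := eval_op Q f a
    -- The kernel of evaluation is one of the operated ideals in the intersection, so evaluation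
    -- factors through `N`.
    have hI : phiIdeal φ Z ≤ LinearMap.ker (evalHom Q f).toLinearMap := by
      refine sInf_le ⟨⟨fun a b hb => ?_, fun a b ha => ?_, fun a ha => ?_⟩, fun a b => ?_⟩
      · simp only [LinearMap.mem_ker, AlgHom.toLinearMap_apply] at hb ⊢
        rw [map_mul, hb, mul_zero]
      · simp only [LinearMap.mem_ker, AlgHom.toLinearMap_apply] at ha ⊢
        rw [map_mul, ha, zero_mul]
      · simp only [LinearMap.mem_ker, AlgHom.toLinearMap_apply] at ha ⊢
        rw [hop, ha, map_zero]
      · exact (map_eval (P := op k Z) ![a, b] (evalHom Q f) hop φ).trans (hQ _)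
    have hN {a b : FreeOp k Z} (h : N a = N b) : evalHom Q f a = evalHom Q f b := by
      rw [← sub_eq_zero, ← map_sub] at h ⊢
      exact hI ((hker _).1 h)
    have hS (a : FreeOp k Z) : evalHom Q f (Function.surjInv hs (N a)) = evalHom Q f a :=
      hN (Function.surjInv_eq hs _)
    let g : A →ₐ[k] R :=
      { toFun := fun a => evalHom Q f (Function.surjInv hs a)
        map_one' := by rw [← map_one N, hS, map_one]
        map_mul' := fun a b => by
          obtain ⟨a, rfl⟩ := hs a
          obtain ⟨b, rfl⟩ := hs b
          rw [← map_mul N, hS, hS, hS, map_mul]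
        map_zero' := by rw [← map_zero N, hS, map_zero]
        map_add' := fun a b => by
          obtain ⟨a, rfl⟩ := hs a
          obtain ⟨b, rfl⟩ := hs b
          rw [← map_add N, hS, hS, hS, map_add]
        commutes' := fun c => by rw [← N.commutes, hS, AlgHom.commutes] }
    have hg (a : FreeOp k Z) : g (N a) = evalHom Q f a := hS a
    refine ⟨g, ⟨fun a => ?_, fun z => ?_⟩, ?_⟩
    · obtain ⟨a, rfl⟩ := hs a
      rw [← hP, hg, hg, hop]
    · rw [← hi, hg]
      exact (eval_mon Q f _).trans (evalWord_var Q f z)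
    · rintro g' ⟨h₁, h₂⟩
      have key : (g'.comp N).toLinearMap = (evalHom Q f).toLinearMap := by
        refine linearMap_ext_mon fun a => ?_
        change g' (N (mon k a)) = eval Q f (mon k a)
        rw [eval_mon]
        induction a with
        | one => exact (congrArg g' (map_one N)).trans (map_one g')
        | consVar z w ih =>
          rw [← BW.var_mul, ← mon_mul_mon, map_mul, map_mul, hi, h₂, ih, evalWord_mul,
            evalWord_var]
        | consBr x w ihx ih =>
          rw [← BW.br_mul, ← mon_mul_mon, map_mul, map_mul, ← op_mon, hP, h₁, ihx, ih,
            evalWord_mul, evalWord_br]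
      ext a
      obtain ⟨a, rfl⟩ := hs a
      rw [hg]
      exact congr($key a)

/-- Replaces the chosen decomposition in `diamondWord` by an unspecified one, which is all that is
needed modulo the ideal. -/
theorem diamondWord_of_exists (B : FreeOp k (Fin 2)) (red : FreeOp k Z →ₗ[k] RBSpan k Z)
    (u v : RBW Z) (h : ∃ p : (BW Z × BW Z) × (BW Z × BW Z),
      u.1 = p.1.1 * p.1.2.br ∧ v.1 = p.2.1.br * p.2.2) :
    ∃ (a s t b : BW Z) (_ : u.1 = a * s.br) (_ : v.1 = t.br * b)
      (hab : ∀ m : RBW Z, (a * m.1.br * b).IsRBNF), diamondWord B red u v =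
        Finsupp.linearCombination k
          (fun m : RBW Z => Finsupp.single (⟨a * m.1.br * b, hab m⟩ : RBW Z) (1 : k))
          (red (subst₂ B (mon k s) (mon k t))) :=
  ⟨_, _, _, _, h.choose_spec.1, h.choose_spec.2, _, dif_pos h⟩

theorem incl_glue {a b : BW Z} (hab : ∀ m : RBW Z, (a * m.1.br * b).IsRBNF) (x : RBSpan k Z) :
    incl k Z (Finsupp.linearCombination k
      (fun m : RBW Z => Finsupp.single (⟨a * m.1.br * b, hab m⟩ : RBW Z) (1 : k)) x) =
      mon k a * op k Z (incl k Z x) * mon k b := by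
  have e : incl k Z ∘ₗ Finsupp.linearCombination k
      (fun m : RBW Z => Finsupp.single (⟨a * m.1.br * b, hab m⟩ : RBW Z) (1 : k)) =
      (LinearMap.mul k (FreeOp k Z)).flip (mon k b) ∘ₗ LinearMap.mulLeft k (mon k a) ∘ₗ
        op k Z ∘ₗ incl k Z := by
    refine Finsupp.lhom_ext' fun w => LinearMap.ext_ring ?_
    simp only [LinearMap.comp_apply, Finsupp.lsingle_apply, Finsupp.linearCombination_single,
      one_smul, incl_single, op_mon, LinearMap.mulLeft_apply, LinearMap.flip_apply,
      LinearMap.mul_apply', mon_mul_mon]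
    exact incl_single _
  exact congr($e x)

/-- A linear retraction `red` of `k𝔐(Z)` onto `kℜ(Z)` with kernel `I_φ(Z)`. -/
structure IsReduction (B : FreeOp k (Fin 2)) (red : FreeOp k Z →ₗ[k] RBSpan k Z) : Prop where
  red_incl : ∀ a, red (incl k Z a) = a
  red_eq_zero : ∀ f, red f = 0 ↔ f ∈ phiIdeal (phi B) Z

/-! ### Transport of the quotient multiplication to `kℜ(Z)` -/

namespace IsReduction

variable {red : FreeOp k Z →ₗ[k] RBSpan k Z}

theorem red_eq_iff (h : IsReduction B red) {f g : FreeOp k Z} :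
    red f = red g ↔ f - g ∈ phiIdeal (phi B) Z := by
  rw [← h.red_eq_zero, map_sub, sub_eq_zero]

theorem incl_red_sub_mem (h : IsReduction B red) (f : FreeOp k Z) :
    incl k Z (red f) - f ∈ phiIdeal (phi B) Z := by
  rw [← h.red_eq_iff, h.red_incl]

/-- Modulo the ideal, `a⌊s⌋⌊t⌋b` equals `a⌊B(s,t)⌋b`, and `B(s,t)` may be replaced by its reduction.
The result is already in `kℜ(Z)`, hence fixed by `red`. -/
theorem diamondWord_eq (h : IsReduction B red) (u v : RBW Z) :
    diamondWord B red u v = red (mon k (u.1 * v.1)) := by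
  have hI := isOperatedIdeal_phiIdeal (phi B) Z
  by_cases hp : ∃ p : (BW Z × BW Z) × (BW Z × BW Z),
      u.1 = p.1.1 * p.1.2.br ∧ v.1 = p.2.1.br * p.2.2
  · obtain ⟨a, s, t, b, e₁, e₂, pf, e⟩ := diamondWord_of_exists B red u v hp
    refine e.trans ((h.red_incl _).symm.trans ((congrArg red (incl_glue pf _)).trans ?_))
    rw [h.red_eq_iff, e₁, e₂]
    have m₁ := hI.mul_right _ (mon k b) (hI.mul_left (mon k a) _ (hI.op_mem _
      (h.incl_red_sub_mem (subst₂ B (mon k s) (mon k t)))))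
    have m₂ := hI.mul_right _ (mon k b) (hI.mul_left (mon k a) _
      (subst₂_mem_phiIdeal (phi B) (mon k s) (mon k t)))
    have := sub_mem m₁ m₂
    rw [subst₂_phi, op_mon, op_mon] at this
    simpa [mul_sub, sub_mul, mon_mul_mon, mul_assoc] using this
  · refine (dif_neg hp).trans ((h.red_incl _).symm.trans ?_)
    exact congrArg red (incl_single _)

theorem diamond_eq (h : IsReduction B red) (a b : RBSpan k Z) :
    diamond B red a b = red (incl k Z a * incl k Z b) := by
  have : diamond B red =
      ((LinearMap.mul k (FreeOp k Z)).compl₁₂ (incl k Z) (incl k Z)).compr₂ red := by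
    refine Finsupp.lhom_ext' fun u => LinearMap.ext_ring ?_
    refine Finsupp.lhom_ext' fun v => LinearMap.ext_ring ?_
    simp [diamond, incl_single, mon_mul_mon, h.diamondWord_eq]
  exact congr($this a b)

theorem red_mul (h : IsReduction B red) (f g : FreeOp k Z) :
    red (f * g) = diamond B red (red f) (red g) := by
  have hI := isOperatedIdeal_phiIdeal (phi B) Z
  rw [h.diamond_eq, eq_comm, h.red_eq_iff]
  have m₁ := hI.mul_right _ (incl k Z (red g)) (h.incl_red_sub_mem f)
  have m₂ := hI.mul_left f _ (h.incl_red_sub_mem g)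
  have := add_mem m₁ m₂
  simpa [mul_sub, sub_mul] using this

theorem red_op (h : IsReduction B red) (f : FreeOp k Z) : red (op k Z f) = rbOp k Z (red f) := by
  have e : incl k Z ∘ₗ rbOp k Z = op k Z ∘ₗ incl k Z := by
    refine Finsupp.lhom_ext' fun w => LinearMap.ext_ring ?_
    simp only [rbOp, LinearMap.comp_apply, Finsupp.lsingle_apply,
      Finsupp.linearCombination_single, one_smul, incl_single, op_mon]
    exact incl_single _
  have e' : incl k Z (rbOp k Z (red f)) = op k Z (incl k Z (red f)) := congr($e (red f))
  rw [← h.red_incl (rbOp k Z (red f)), e', eq_comm, h.red_eq_iff, ← map_sub]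
  exact (isOperatedIdeal_phiIdeal (phi B) Z).op_mem _ (h.incl_red_sub_mem f)

theorem red_one (h : IsReduction B red) : red 1 = rbOne k Z := by
  rw [← h.red_incl (rbOne k Z)]
  exact congrArg red (incl_single (⟨1, .one⟩ : RBW Z)).symm

theorem red_surjective (h : IsReduction B red) : Function.Surjective red :=
  fun a => ⟨_, h.red_incl a⟩

theorem isUnitalAssoc (h : IsReduction B red) : IsUnitalAssoc (diamond B red) (rbOne k Z) where
  mul_assoc a b c := by
    obtain ⟨a, rfl⟩ := h.red_surjective a
    obtain ⟨b, rfl⟩ := h.red_surjective b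
    obtain ⟨c, rfl⟩ := h.red_surjective c
    rw [← h.red_mul, ← h.red_mul, ← h.red_mul, ← h.red_mul, mul_assoc]
  one_mul a := by
    obtain ⟨a, rfl⟩ := h.red_surjective a
    rw [← h.red_one, ← h.red_mul, one_mul]
  mul_one a := by
    obtain ⟨a, rfl⟩ := h.red_surjective a
    rw [← h.red_one, ← h.red_mul, mul_one]

/-- For the product `◇`, `red` is a surjective morphism of operated algebras with kernel `I_φ(Z)`.
-/
theorem diamondIsFree (h : IsReduction B red) : DiamondIsFree.{u, v, w} B Z red := by
  refine ⟨h.isUnitalAssoc, ?_⟩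
  let _ := ringOf h.isUnitalAssoc
  let _ := algebraOf h.isUnitalAssoc
  let N : FreeOp k Z →ₐ[k] RBSpan k Z := AlgHom.ofLinearMap red h.red_one h.red_mul
  refine isFreePhiAlgebra_of_surjective (rbOp k Z) (rbVar k) N h.red_surjective h.red_op
    (fun z => ?_) h.red_eq_zero
  change red (mon k (BW.var z)) = _
  rw [← h.red_incl (rbVar k z)]
  exact congrArg red (incl_single (⟨BW.var z, .var z⟩ : RBW Z)).symm

end IsReduction

end Free

end

end RotaBaxterType

/-! ### The main theorem -/

open RotaBaxterType in
theorem mainTheorem1 {k : Type u} [CommRing k] [Nontrivial k] (c lam : k) (t : Item) :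
    -- the expression and its operator are of Rota-Baxter type
    IsRotaBaxterType.{u, v} (phi (t.expr c lam)) ∧
    ∀ (Z : Type v) [LinearOrder Z] [WellFoundedLT Z],
      -- `≤_db` is a monomial order compatible with the rewriting system
      (IsMonomialOrder (DbLT (Z := Z)) ∧ IsCompatible (t.expr c lam) (DbLT (Z := Z))) ∧
      -- convergence, and the Gröbner-Shirshov property for `≤_db` and for every other compatible
      -- monomial order
      (Convergent (rbSystem (t.expr c lam) Z) ∧
        IsGSBasis DbLT (monGenerators (phi (t.expr c lam)) Z) ∧
        ∀ lt : BW Z → BW Z → Prop, IsMonomialOrder lt → IsCompatible (t.expr c lam) lt →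
          IsGSBasis lt (monGenerators (phi (t.expr c lam)) Z)) ∧
      -- the construction of the free algebra
      ∃ e : RBSpan k Z ≃ₗ[k] PhiQuot (phi (t.expr c lam)) Z,
        (∀ f, e f = (phiIdeal (phi (t.expr c lam)) Z).mkQ (incl k Z f)) ∧
        (∃ b : Module.Basis (RBW Z) k (PhiQuot (phi (t.expr c lam)) Z),
          ∀ w, b w = (phiIdeal (phi (t.expr c lam)) Z).mkQ (mon k w.1)) ∧
        DiamondIsFree.{u, v, w} (t.expr c lam) Z
          (e.symm.toLinearMap ∘ₗ (phiIdeal (phi (t.expr c lam)) Z).mkQ) := by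
  have hB := t.expr_mem_suppIn c lam
  refine ⟨isRotaBaxterType_phi hB fun Z => isAssociative_expr c lam t, fun Z _ _ => ?_⟩
  have hA := isAssociative_expr (Z := Z) c lam t
  refine ⟨⟨DbLT.isMonomialOrder, isCompatible_dbLT hB⟩,
    ⟨convergent_rbSystem hB hA,
      isGSBasis_monGenerators DbLT.isMonomialOrder (isCompatible_dbLT hB) hB hA,
      fun lt hlt hc => isGSBasis_monGenerators hlt hc hB hA⟩, ?_⟩
  let e := LinearEquiv.ofBijective _ (bijective_mkQ_incl hB hA)
  have he (f) : e f = (phiIdeal (phi (t.expr c lam)) Z).mkQ (incl k Z f) := rfl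
  -- As `kℜ(Z)` consists of finitely supported functions on `ℜ(Z)`, the inverse of `e` is the
  -- coordinate map of the basis.
  refine ⟨e, he, ⟨⟨e.symm⟩, fun w => ?_⟩, IsReduction.diamondIsFree ⟨fun a => ?_, fun f => ?_⟩⟩
  · change e (Finsupp.single w 1) = _
    rw [he, incl_single]
  · rw [LinearMap.comp_apply, ← he]
    exact e.symm_apply_apply a
  · simp
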